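/- Let $\Bbbk$ be an algebraically closed field and $R=\Bbbk[x_0,x_1,x_2]$. A finite set $\mathbb X\subseteq\mathbb P^2=\mathbb P^2_\Bbbk$ is called a $\Bbbk$-configuration of type $(d_1,\dots,d_s)$, where $s\ge 1$ and $1\le d_1<\cdots<d_s$ are integers, if there are subsets $\mathbb X_1,\dots,\mathbb X_s$ of $\mathbb X$ and distinct lines $\mathbb L_1,\dots,\mathbb L_s\subseteq\mathbb P^2$ such that (1) $\mathbb X=\bigcup_{i=1}^s\mathbb X_i$; (2) $|\mathbb X_i|=d_i$ and $\mathbb X_i\subseteq\mathbb L_i$ for $i=1,\dots,s$; and (3) for $1<i\le s$ the line $\mathbb L_i$ contains no point of $\mathbb X_j$ for any $1\le j<i$. For an integer $m\geq 1$ let $I_{m\mathbb X}=\bigcap_{P\in\mathbb X}I_P^m$, where $I_P\subseteq R$ is the homogeneous ideal of the point $P$; let $H_{m\mathbb X}(t)=\dim_\Bbbk R_t-\dim_\Bbbk (I_{m\mathbb X})_t$ for $t\ge 0$ and $H_{m\mathbb X}(-1)=0$; and let $\Delta H_{m\mathbb X}(t)=H_{m\mathbb X}(t)-H_{m\mathbb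 X}(t-1)$ for $t\ge 0$. Let $\mathbb X\subseteq\mathbb P^2$ be a $\Bbbk$-configuration of type $(d_1,\dots,d_s)\neq(1)$ and let $m\ge s+1$. Then the number of lines of $\mathbb P^2$ containing exactly $d_s$ points of $\mathbb X$ is finite and equals the last nonzero value of $\Delta H_{m\mathbb X}$; that is, there is an integer $t\ge 0$ such that $\Delta H_{m\mathbb X}(t)\neq 0$, $\Delta H_{m\mathbb X}(u)=0$ for all $u>t$, and $\Delta H_{m\mathbb X}(t)$ is the number of lines containing exactly $d_s$ points of $\mathbb X$. -/

import Mathlib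

open scoped LinearAlgebra.Projectivization

noncomputable section

namespace KConf

/-- The projective plane over `K`. -/
abbrev Plane (K : Type*) [Field K] := ℙ K (Fin 3 → K)

/-- A line of the projective plane, given by a two-dimensional linear subspace of `K³`. -/
abbrev Line (K : Type*) [Field K] :=
  {L : Submodule K (Fin 3 → K) // Module.finrank K L = 2}

/-- The set of points of the projective plane that lie on the line `L`. -/
def Line.points {K : Type*} [Field K] (L : Line K) : Set (Plane K) :=
  {P | P.submodule ≤ L.1}

/-- `X` is a `𝕜`-configuration of type `d = (d₁, …, dₛ)`; the indices `1, …, s` are the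
elements of `Fin s` in increasing order. -/
def IsKConfiguration {K : Type*} [Field K] (X : Finset (Plane K)) {s : ℕ}
    (d : Fin s → ℕ) : Prop :=
  (∀ i, 1 ≤ d i) ∧ StrictMono d ∧
    ∃ (Y : Fin s → Finset (Plane K)) (L : Fin s → Line K),
      Function.Injective L ∧
      (X : Set (Plane K)) = ⋃ i, (Y i : Set (Plane K)) ∧
      (∀ i, (Y i).card = d i ∧ (Y i : Set (Plane K)) ⊆ (L i).points) ∧
      (∀ i j, j < i → ∀ P ∈ Y j, P ∉ (L i).points)

/-- The homogeneous ideal of a point `P` in `K[x₀, x₁, x₂]`, generated by the homogeneous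
polynomials vanishing at `P` (for these, vanishing does not depend on the representative). -/
def pointIdeal {K : Type*} [Field K] (P : Plane K) : Ideal (MvPolynomial (Fin 3) K) :=
  Ideal.span {f | (∃ n, f.IsHomogeneous n) ∧ MvPolynomial.eval P.rep f = 0}

/-- The ideal of the homogeneous fat point scheme `mX`, the intersection of the ideals
`I_P ^ m` for `P ∈ X`. -/
def fatIdeal {K : Type*} [Field K] (m : ℕ) (X : Finset (Plane K)) :
    Ideal (MvPolynomial (Fin 3) K) :=
  ⨅ P ∈ X, pointIdeal P ^ m

/-- The degree `t` component of an ideal, as a space of homogeneous polynomials. -/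
def gradedPart {K : Type*} [Field K] (I : Ideal (MvPolynomial (Fin 3) K)) (t : ℕ) :
    Submodule K (MvPolynomial (Fin 3) K) :=
  MvPolynomial.homogeneousSubmodule (Fin 3) K t ⊓ I.restrictScalars K

/-- The Hilbert function `t ↦ dim R_t - dim I_t` of `R / I`, with values in `ℤ`. -/
def hilbertFunction {K : Type*} [Field K] (I : Ideal (MvPolynomial (Fin 3) K)) (t : ℕ) : ℤ :=
  (Module.finrank K (MvPolynomial.homogeneousSubmodule (Fin 3) K t) : ℤ) -
    (Module.finrank K (gradedPart I t) : ℤ)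

/-- The first difference of `H`, with the convention `H (-1) = 0`. -/
def firstDifference (H : ℕ → ℤ) : ℕ → ℤ
  | 0 => H 0
  | t + 1 => H (t + 1) - H t

/-- `f` has a last nonzero value, and this value is `v`. -/
def IsLastNonzeroValue (f : ℕ → ℤ) (v : ℤ) : Prop :=
  ∃ t, f t = v ∧ v ≠ 0 ∧ ∀ u, t < u → f u = 0

/-- The set of all lines that contain exactly `n` points of `X`. -/
def linesWithExactly {K : Type*} [Field K] (X : Finset (Plane K)) (n : ℕ) : Set (Line K) :=
  {L | ((X : Set (Plane K)) ∩ L.points).ncard = n}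

end KConf

end

/-!
For multiplicities `μ` on `X` let the defect in degree `t - 1` be the number of conditions by which
the fat points fail to impose independent conditions on forms of that degree; then `ΔH(t)` is the
defect in degree `t - 1` minus the defect in degree `t`. Restricting forms to a line `L` and
dividing those that vanish on `L` by its equation compares `μ` in degree `t` with the multiplicities
lowered by one along `L` in degree `t - 1`: the defect does not decrease if `∑_{P ∈ L} μ P ≤ t + 1`,
and it drops by exactly one if `∑_{P ∈ L} μ P = t + 2`.

Call a line full if it has `dₛ` points of `X`, the largest possible number. Any two full lines meet
in a point of `X`, so peeling them off one after the other from `m X`, starting in degree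
`m dₛ - 2`, satisfies the equality each time: each full line accounts for one unit of defect. What
remains has defect zero, as one sees by peeling off the other lines `𝕃ᵢ` and then comparing with
smaller multiplicities `c`, which impose independent conditions from degree `c dₛ - 1` on. For type
`(1, 2, …, s)` there may be full lines other than the `𝕃ᵢ`, but these join the point of `𝕏₁` to a
point of `𝕏₂`; there the lines `𝕃ₛ, …, 𝕃₃` are peeled off an additional time, so that the
remaining lines no longer carry too many points of full multiplicity.
-/

namespace KConf

open scoped LinearAlgebra.Projectivization Pointwise
open MvPolynomial Module

variable {K : Type*} [Field K]

theorem aeval_mul_left_of_isHomogeneous {R σ A : Type*} [CommSemiring R] [CommSemiring A]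
    [Algebra R A] {f : MvPolynomial σ R} {n : ℕ} (hf : f.IsHomogeneous n) (c : A) (g : σ → A) :
    aeval (fun i => c * g i) f = c ^ n * aeval g f := by
  rw [aeval_def, aeval_def, eval₂_eq, eval₂_eq, Finset.mul_sum]
  refine Finset.sum_congr rfl fun d hd => ?_
  rw [hf.degree_eq_sum_deg_support hd, ← Finset.prod_pow_eq_pow_sum]
  simp only [mul_pow, Finset.prod_mul_distrib]
  ring

section LinearForms

variable {σ : Type*} [Fintype σ]

/-- The linear form `∑ i, c i • X i` with coefficient vector `c`. -/
noncomputable def linForm : (σ → K) →ₗ[K] MvPolynomial σ K :=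
  Fintype.linearCombination K X

theorem linForm_apply (c : σ → K) : linForm c = ∑ i, C (c i) * X i := by
  simp only [linForm, Fintype.linearCombination_apply, smul_eq_C_mul]

theorem linForm_single [DecidableEq σ] (i : σ) (a : K) :
    linForm (Pi.single i a) = C a * X i := by
  rw [linForm, Fintype.linearCombination_apply_single, smul_eq_C_mul]

theorem isHomogeneous_linForm (c : σ → K) : (linForm c).IsHomogeneous 1 := by
  rw [linForm_apply]
  exact IsHomogeneous.sum _ _ _ fun _ _ => isHomogeneous_C_mul_X _ _

theorem aeval_linForm {A : Type*} [CommSemiring A] [Algebra K A] (g : σ → A) (c : σ → K) :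
    aeval g (linForm c) = ∑ i, c i • g i := by
  simp [linForm_apply, Algebra.smul_def]

theorem eval_linForm (c x : σ → K) : eval x (linForm c) = c ⬝ᵥ x := by
  simp [linForm_apply, dotProduct]

theorem linForm_injective : Function.Injective (linForm : (σ → K) → MvPolynomial σ K) := by
  classical
  intro c d h
  ext i
  have := congrArg (eval (Pi.single i 1)) h
  simpa [eval_linForm] using this

end LinearForms

section PointIdeals

theorem mem_pointIdeal_of_eval_eq_zero {P : Plane K} {f : MvPolynomial (Fin 3) K} {n : ℕ}
    (hf : f.IsHomogeneous n) (h : eval P.rep f = 0) : f ∈ pointIdeal P :=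
  Ideal.subset_span ⟨⟨n, hf⟩, h⟩

theorem eval_eq_zero_of_mem_pointIdeal {P : Plane K} {f : MvPolynomial (Fin 3) K}
    (hf : f ∈ pointIdeal P) : eval P.rep f = 0 := by
  have : pointIdeal P ≤ RingHom.ker (eval P.rep) := by
    rw [pointIdeal, Ideal.span_le]
    exact fun _ hg => hg.2
  exact this hf

theorem linForm_mem_pointIdeal {P : Plane K} {c : Fin 3 → K} (hc : c ⬝ᵥ P.rep = 0) :
    linForm c ∈ pointIdeal P :=
  mem_pointIdeal_of_eval_eq_zero (isHomogeneous_linForm c) (by rw [eval_linForm, hc])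

theorem exists_dotProduct_rep_eq_one (P : Plane K) : ∃ e : Fin 3 → K, e ⬝ᵥ P.rep = 1 := by
  obtain ⟨j, hj⟩ := Function.ne_iff.mp P.rep_nonzero
  exact ⟨Pi.single j (P.rep j)⁻¹, by simpa using inv_mul_cancel₀ hj⟩

/-- The coefficients of a linear form with value `1` at the representative of `P`. -/
noncomputable def unitCovector (P : Plane K) : Fin 3 → K :=
  (exists_dotProduct_rep_eq_one P).choose

theorem unitCovector_dotProduct_rep (P : Plane K) : unitCovector P ⬝ᵥ P.rep = 1 :=
  (exists_dotProduct_rep_eq_one P).choose_spec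

theorem sub_smul_unitCovector_dotProduct_rep (P : Plane K) (c : Fin 3 → K) :
    (c - (c ⬝ᵥ P.rep) • unitCovector P) ⬝ᵥ P.rep = 0 := by
  simp [unitCovector_dotProduct_rep]

theorem pointIdeal_eq_span_linForm (P : Plane K) :
    pointIdeal P = Ideal.span (linForm '' {c | c ⬝ᵥ P.rep = 0}) := by
  refine le_antisymm ?_ (Ideal.span_le.mpr ?_)
  · set J := Ideal.span (linForm '' {c | c ⬝ᵥ P.rep = 0})
    set u := linForm (unitCovector P)
    -- Modulo `J` every variable is congruent to its value at `P` times `u`.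
    have hmk : Ideal.Quotient.mkₐ K J =
        (Ideal.Quotient.mkₐ K J).comp (aeval fun i => u * C (P.rep i)) := by
      ext i : 1
      rw [AlgHom.comp_apply, aeval_X, Ideal.Quotient.mkₐ_eq_mk, Ideal.Quotient.eq]
      have hmem : linForm (Pi.single i 1 - (Pi.single i 1 ⬝ᵥ P.rep) • unitCovector P) ∈ J :=
        Ideal.subset_span ⟨_, sub_smul_unitCovector_dotProduct_rep P _, rfl⟩
      convert hmem using 1
      simp only [single_dotProduct, one_mul, map_sub, map_smul, linForm_single, C_1,
        mul_comm u, smul_eq_C_mul, u]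
    refine Ideal.span_le.mpr fun f ⟨⟨n, hf⟩, h0⟩ => ?_
    have heval : aeval (fun i => C (P.rep i)) f = (C (eval P.rep f) : MvPolynomial (Fin 3) K) := by
      rw [← aeval_eq_eval, ← algebraMap_eq, ← aeval_algebraMap_apply]
      rfl
    rw [SetLike.mem_coe, ← Ideal.Quotient.eq_zero_iff_mem, ← Ideal.Quotient.mkₐ_eq_mk K, hmk,
      AlgHom.comp_apply, aeval_mul_left_of_isHomogeneous hf, heval, h0, C_0, mul_zero, map_zero]
  · rintro _ ⟨c, hc, rfl⟩
    exact linForm_mem_pointIdeal hc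

/-- The substitution contracting the plane towards `P` by a factor `T`, the variable of
`Polynomial`; the order of vanishing in `T` is the multiplicity at `P`. -/
noncomputable def contraction (P : Plane K) :
    MvPolynomial (Fin 3) K →ₐ[K] Polynomial (MvPolynomial (Fin 3) K) :=
  aeval fun i => Polynomial.C (P.rep i • linForm (unitCovector P)) +
    Polynomial.X * Polynomial.C (X i - P.rep i • linForm (unitCovector P))

theorem contraction_linForm (P : Plane K) (c : Fin 3 → K) :
    contraction P (linForm c) = Polynomial.C ((c ⬝ᵥ P.rep) • linForm (unitCovector P)) +
      Polynomial.X * Polynomial.C (linForm (c - (c ⬝ᵥ P.rep) • unitCovector P)) := by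
  set u := linForm (unitCovector P) with hu
  have hsum : (c ⬝ᵥ P.rep) • u = ∑ i, c i • P.rep i • u := by
    simp only [dotProduct, Finset.sum_smul, mul_smul]
  rw [contraction, aeval_linForm, map_sub, map_smul linForm, ← hu, hsum, linForm,
    Fintype.linearCombination_apply, ← Finset.sum_sub_distrib, map_sum, map_sum, Finset.mul_sum,
    ← Finset.sum_add_distrib]
  refine Finset.sum_congr rfl fun i _ => ?_
  rw [← smul_sub, smul_add, ← Polynomial.smul_C (c i), ← Polynomial.smul_C (c i), mul_smul_comm]

theorem eval_one_contraction (P : Plane K) (f : MvPolynomial (Fin 3) K) :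
    (contraction P f).eval 1 = f := by
  have : ((Polynomial.aeval (1 : MvPolynomial (Fin 3) K)).restrictScalars K).comp
      (contraction P) = AlgHom.id K _ := by
    ext i : 1
    simp [contraction]
  simpa [Polynomial.aeval_def] using congrArg (fun φ => φ f) this

theorem coeff_contraction_mem (P : Plane K) (f : MvPolynomial (Fin 3) K) (k : ℕ) :
    (contraction P f).coeff k ∈ pointIdeal P ^ k := by
  suffices contraction P f ∈ reesAlgebra (pointIdeal P) from this k
  induction f using MvPolynomial.induction_on with
  | C a =>
    rw [contraction, aeval_C]
    exact Subalgebra.algebraMap_mem (reesAlgebra (pointIdeal P)) (C a)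
  | add f g hf hg => rw [map_add]; exact add_mem hf hg
  | mul_X f i hf =>
    rw [map_mul]
    refine mul_mem hf ?_
    rw [← one_mul (X i), ← C_1, ← linForm_single, contraction_linForm]
    refine add_mem (Subalgebra.algebraMap_mem (reesAlgebra (pointIdeal P)) _) ?_
    rw [mul_comm, ← Polynomial.monomial_one_one_eq_X, Polynomial.C_mul_monomial, mul_one,
      reesAlgebra.monomial_mem, pow_one]
    exact linForm_mem_pointIdeal (sub_smul_unitCovector_dotProduct_rep P _)

theorem X_dvd_contraction {P : Plane K} {f : MvPolynomial (Fin 3) K} (hf : f ∈ pointIdeal P) :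
    Polynomial.X ∣ contraction P f := by
  suffices pointIdeal P ≤ (Ideal.span {Polynomial.X}).comap (contraction P) from
    Ideal.mem_span_singleton.mp (this hf)
  rw [pointIdeal_eq_span_linForm, Ideal.span_le]
  rintro _ ⟨c, hc, rfl⟩
  rw [SetLike.mem_coe, Ideal.mem_comap, Ideal.mem_span_singleton, contraction_linForm,
    show c ⬝ᵥ P.rep = 0 from hc, zero_smul, Polynomial.C_0, zero_add]
  exact dvd_mul_right _ _

theorem mem_pointIdeal_pow_iff {P : Plane K} {f : MvPolynomial (Fin 3) K} {m : ℕ} :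
    f ∈ pointIdeal P ^ m ↔ Polynomial.X ^ m ∣ contraction P f := by
  constructor
  · intro hf
    have hle : (pointIdeal P).map (contraction P) ≤ Ideal.span {Polynomial.X} :=
      Ideal.map_le_iff_le_comap.mpr fun g hg =>
        Ideal.mem_span_singleton.mpr (X_dvd_contraction hg)
    have hmem := Ideal.mem_map_of_mem (contraction P) hf
    rw [Ideal.map_pow] at hmem
    simpa only [Ideal.span_singleton_pow, Ideal.mem_span_singleton] using
      Ideal.pow_right_mono hle m hmem
  · intro h
    rw [Polynomial.X_pow_dvd_iff] at h
    rw [← eval_one_contraction P f, Polynomial.eval_eq_sum, Polynomial.sum]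
    refine Ideal.sum_mem _ fun k _ => ?_
    rw [one_pow, mul_one]
    by_cases hk : k < m
    · rw [h k hk]
      exact zero_mem _
    · exact Ideal.pow_le_pow_right (not_lt.mp hk) (coeff_contraction_mem P f k)

theorem mem_pow_of_mul_mem_pow {P : Plane K} {f g : MvPolynomial (Fin 3) K} {m : ℕ}
    (hf : eval P.rep f ≠ 0) (h : f * g ∈ pointIdeal P ^ m) : g ∈ pointIdeal P ^ m := by
  rw [mem_pointIdeal_pow_iff] at h ⊢
  rw [map_mul] at h
  refine Polynomial.prime_X.pow_dvd_of_dvd_mul_left _ (fun hX => hf ?_) h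
  rw [← pow_one Polynomial.X, ← mem_pointIdeal_pow_iff, pow_one] at hX
  exact eval_eq_zero_of_mem_pointIdeal hX

theorem mem_pow_pred_of_linForm_mul_mem_pow {P : Plane K} {c : Fin 3 → K} (hc : c ≠ 0)
    (hP : c ⬝ᵥ P.rep = 0) {g : MvPolynomial (Fin 3) K} {m : ℕ}
    (h : linForm c * g ∈ pointIdeal P ^ m) : g ∈ pointIdeal P ^ (m - 1) := by
  rcases m with _ | m
  · simp
  rw [mem_pointIdeal_pow_iff, map_mul, contraction_linForm, hP, zero_smul, Polynomial.C_0,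
    zero_add, zero_smul, sub_zero, mul_assoc, pow_succ',
    mul_dvd_mul_iff_left Polynomial.X_ne_zero] at h
  rw [mem_pointIdeal_pow_iff, Nat.add_sub_cancel]
  refine Polynomial.prime_X.pow_dvd_of_dvd_mul_left _ ?_ h
  rwa [Polynomial.X_dvd_iff, Polynomial.coeff_C_zero, map_eq_zero_iff _ linForm_injective]

end PointIdeals

section Dimensions

instance finite_homogeneousSubmodule {σ : Type*} [Finite σ] (t : ℕ) :
    Module.Finite K (homogeneousSubmodule σ K t) :=
  Module.Finite.iff_fg.mpr (homogeneousSubmodule_fg _ _ t)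

theorem finrank_homogeneousSubmodule (n t : ℕ) :
    finrank K (homogeneousSubmodule (Fin (n + 1)) K t) = (t + n).choose n := by
  have hS : ∀ d : Fin (n + 1) →₀ ℕ,
      d ∈ Finset.univ.finsuppAntidiag t ↔ d ∈ {d | d.degree = t} := by
    intro d
    simp [Finset.mem_finsuppAntidiag, Finsupp.degree_eq_sum]
  let _ : Fintype {d : Fin (n + 1) →₀ ℕ | d.degree = t} := Fintype.ofFinset _ hS
  rw [homogeneousSubmodule_eq_finsupp_supported,
    (AddMonoidAlgebra.supportedEquivFinsupp (R := K) (S := K)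
      {d : Fin (n + 1) →₀ ℕ | d.degree = t}).finrank_eq, Module.finrank_finsupp_self,
    Fintype.card_ofFinset, Finset.card_finsuppAntidiag_nat_eq_choose, Finset.card_univ,
    Fintype.card_fin, show n + 1 + t - 1 = t + n by omega, Nat.choose_symm_add]

theorem mem_gradedPart {I : Ideal (MvPolynomial (Fin 3) K)} {t : ℕ}
    {f : MvPolynomial (Fin 3) K} : f ∈ gradedPart I t ↔ f.IsHomogeneous t ∧ f ∈ I := by
  rw [gradedPart, Submodule.mem_inf, mem_homogeneousSubmodule, Submodule.restrictScalars_mem]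

theorem gradedPart_le (I : Ideal (MvPolynomial (Fin 3) K)) (t : ℕ) :
    gradedPart I t ≤ homogeneousSubmodule (Fin 3) K t := inf_le_left

instance finite_gradedPart (I : Ideal (MvPolynomial (Fin 3) K)) (t : ℕ) :
    Module.Finite K (gradedPart I t) :=
  Submodule.finiteDimensional_of_le (gradedPart_le I t)

theorem exists_homogeneousSubmodule_one_le_span (P : Plane K) :
    ∃ y ∈ gradedPart (pointIdeal P) 1, ∃ z ∈ gradedPart (pointIdeal P) 1,
      homogeneousSubmodule (Fin 3) K 1 ≤ Submodule.span K {linForm (unitCovector P), y, z} := by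
  let φ : (Fin 3 → K) →ₗ[K] K := (dotProductBilin K K).flip P.rep
  have hφ : LinearMap.range φ = ⊤ := LinearMap.range_eq_top.mpr fun a =>
    ⟨a • unitCovector P, by simp [φ, unitCovector_dotProduct_rep]⟩
  have hker : finrank K (LinearMap.ker φ) = 2 := by
    have := φ.finrank_range_add_finrank_ker
    rw [hφ, finrank_top, finrank_self, finrank_fin_fun] at this
    omega
  let b := finBasisOfFinrankEq K (LinearMap.ker φ) hker
  have hb (i : Fin 2) : linForm (b i : Fin 3 → K) ∈ gradedPart (pointIdeal P) 1 :=
    mem_gradedPart.mpr ⟨isHomogeneous_linForm _, linForm_mem_pointIdeal (b i).2⟩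
  refine ⟨_, hb 0, _, hb 1, ?_⟩
  rw [homogeneousSubmodule_one_eq_span_X, Submodule.span_le]
  rintro _ ⟨i, rfl⟩
  set c : Fin 3 → K := Pi.single i 1
  let k : LinearMap.ker φ := ⟨c - (c ⬝ᵥ P.rep) • unitCovector P,
    sub_smul_unitCovector_dotProduct_rep P c⟩
  have hk : c = (c ⬝ᵥ P.rep) • unitCovector P + (b.repr k 0 • (b 0 : Fin 3 → K) +
      b.repr k 1 • (b 1 : Fin 3 → K)) := by
    have := congrArg Subtype.val (b.sum_repr k)
    rw [Fin.sum_univ_two] at this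
    exact eq_add_of_sub_eq' this.symm
  rw [SetLike.mem_coe, ← one_mul (X i), ← C_1, ← linForm_single]
  change linForm c ∈ _
  rw [hk, map_add, map_add, map_smul, map_smul, map_smul]
  refine add_mem ?_ (add_mem ?_ ?_) <;>
    exact Submodule.smul_mem _ _ (Submodule.subset_span (by simp))

theorem exists_eq_pow_mul_pow_of_mem_pow {A : Type*} [CommSemiring A] {x y z a : A} {t : ℕ}
    (ha : a ∈ ({x, y, z} : Set A) ^ t) :
    ∃ i j k, i + (j + k) = t ∧ a = x ^ i * (y ^ j * z ^ k) := by
  induction t generalizing a with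
  | zero => exact ⟨0, 0, 0, rfl, by simpa using ha⟩
  | succ t ih =>
    rw [pow_succ, Set.mem_mul] at ha
    obtain ⟨b, hb, c, hc, rfl⟩ := ha
    obtain ⟨i, j, k, h, rfl⟩ := ih hb
    rcases hc with rfl | rfl | rfl
    · exact ⟨i + 1, j, k, by omega, by ring⟩
    · exact ⟨i, j + 1, k, by omega, by ring⟩
    · exact ⟨i, j, k + 1, by omega, by ring⟩

theorem card_biUnion_antidiagonal_le (m : ℕ) :
    ((Finset.range m).biUnion Finset.HasAntidiagonal.antidiagonal).card ≤
      (m + 1).choose 2 := by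
  refine Finset.card_biUnion_le.trans (le_of_eq ?_)
  simp only [Finset.Nat.card_antidiagonal]
  induction m with
  | zero => rfl
  | succ m ih =>
    rw [Finset.sum_range_succ, ih, Nat.choose_succ_succ' (m + 1) 1, Nat.choose_one_right, add_comm]

theorem exists_homogeneousSubmodule_le_sup_span (P : Plane K) (m t : ℕ) :
    ∃ T : Finset (MvPolynomial (Fin 3) K), T.card ≤ (m + 1).choose 2 ∧
      homogeneousSubmodule (Fin 3) K t ≤
        gradedPart (pointIdeal P ^ m) t ⊔ Submodule.span K (T : Set (MvPolynomial (Fin 3) K)) := by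
  classical
  obtain ⟨y, hy, z, hz, hspan⟩ := exists_homogeneousSubmodule_one_le_span P
  rw [mem_gradedPart] at hy hz
  set x := linForm (unitCovector P)
  let monomialOf (q : ℕ × ℕ) := x ^ (t - (q.1 + q.2)) * (y ^ q.1 * z ^ q.2)
  refine ⟨((Finset.range m).biUnion Finset.HasAntidiagonal.antidiagonal).image monomialOf,
    Finset.card_image_le.trans (card_biUnion_antidiagonal_le m), ?_⟩
  rw [← homogeneousSubmodule_one_pow]
  refine (pow_le_pow_left' hspan t).trans ?_
  rw [Submodule.span_pow, Submodule.span_le]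
  intro a ha
  obtain ⟨i, j, k, h, rfl⟩ := exists_eq_pow_mul_pow_of_mem_pow ha
  by_cases hm : j + k < m
  · refine Submodule.mem_sup_right (Submodule.subset_span (Finset.mem_coe.mpr ?_))
    refine Finset.mem_image.mpr ⟨(j, k), by simpa using hm, ?_⟩
    simp only [monomialOf, show t - (j + k) = i by omega]
  · refine Submodule.mem_sup_left (mem_gradedPart.mpr ⟨?_, ?_⟩)
    · simpa only [one_mul, h] using
        ((isHomogeneous_linForm _).pow i).mul ((hy.1.pow j).mul (hz.1.pow k))
    · refine Ideal.mul_mem_left _ _ (Ideal.pow_le_pow_right (not_lt.mp hm) ?_)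
      rw [pow_add]
      exact Ideal.mul_mem_mul (Ideal.pow_mem_pow hy.2 _) (Ideal.pow_mem_pow hz.2 _)

theorem finrank_le_gradedPart_pow (P : Plane K) (m t : ℕ) :
    finrank K (homogeneousSubmodule (Fin 3) K t) ≤
      finrank K (gradedPart (pointIdeal P ^ m) t) + (m + 1).choose 2 := by
  obtain ⟨T, hT, hle⟩ := exists_homogeneousSubmodule_le_sup_span P m t
  calc _ ≤ _ := Submodule.finrank_mono hle
    _ ≤ _ := Submodule.finrank_add_le_finrank_add_finrank _ _
    _ ≤ _ := by
      gcongr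
      exact (finrank_span_finset_le_card T).trans hT

/-- The ideal of the fat point scheme with multiplicity `μ P` at each `P ∈ X`. -/
noncomputable def multIdeal (X : Finset (Plane K)) (μ : Plane K → ℕ) :
    Ideal (MvPolynomial (Fin 3) K) :=
  ⨅ P ∈ X, pointIdeal P ^ μ P

theorem mem_multIdeal {X : Finset (Plane K)} {μ : Plane K → ℕ} {f : MvPolynomial (Fin 3) K} :
    f ∈ multIdeal X μ ↔ ∀ P ∈ X, f ∈ pointIdeal P ^ μ P := by
  simp only [multIdeal, Submodule.mem_iInf]

theorem finrank_le_gradedPart_multIdeal (X : Finset (Plane K)) (μ : Plane K → ℕ) (t : ℕ) :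
    finrank K (homogeneousSubmodule (Fin 3) K t) ≤
      finrank K (gradedPart (multIdeal X μ) t) + ∑ P ∈ X, (μ P + 1).choose 2 := by
  classical
  induction X using Finset.induction_on with
  | empty =>
    have hempty : gradedPart (multIdeal (∅ : Finset (Plane K)) μ) t =
        homogeneousSubmodule (Fin 3) K t := by
      ext f
      simp [mem_gradedPart, mem_multIdeal]
    rw [hempty, Finset.sum_empty, add_zero]
  | insert P X hP ih =>
    have hinf : gradedPart (multIdeal (insert P X) μ) t =
        gradedPart (pointIdeal P ^ μ P) t ⊓ gradedPart (multIdeal X μ) t := by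
      ext f
      simp only [mem_gradedPart, mem_multIdeal, Submodule.mem_inf, Finset.forall_mem_insert]
      tauto
    have hpow := finrank_le_gradedPart_pow P (μ P) t
    have hsup := Submodule.finrank_sup_add_finrank_inf_eq
      (gradedPart (pointIdeal P ^ μ P) t) (gradedPart (multIdeal X μ) t)
    have hle := Submodule.finrank_mono
      (sup_le (gradedPart_le (pointIdeal P ^ μ P) t) (gradedPart_le (multIdeal X μ) t))
    rw [Finset.sum_insert hP, hinf]
    omega

end Dimensions

section BinaryForms

attribute [local instance] MvPolynomial.gradedAlgebra

theorem exists_isHomogeneous_eq_mul {R σ : Type*} [CommSemiring R] {q f : MvPolynomial σ R}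
    {e t : ℕ} (hq : q.IsHomogeneous e) (hf : f.IsHomogeneous (e + t)) (h : q ∣ f) :
    ∃ g : MvPolynomial σ R, g.IsHomogeneous t ∧ f = q * g := by
  obtain ⟨g, rfl⟩ := h
  refine ⟨DirectSum.decompose (homogeneousSubmodule σ R) g t,
    (mem_homogeneousSubmodule _ _).mp (SetLike.coe_mem _), ?_⟩
  rw [← DirectSum.coe_decompose_mul_add_of_left_mem (homogeneousSubmodule σ R) hq]
  exact (DirectSum.decompose_of_mem_same (homogeneousSubmodule σ R) hf).symm

theorem eq_zero_of_isHomogeneous_of_dvd {R σ : Type*} [CommSemiring R] {q f : MvPolynomial σ R}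
    {e t : ℕ} (hq : q.IsHomogeneous e) (hf : f.IsHomogeneous t) (h : q ∣ f) (hlt : t < e) :
    f = 0 := by
  obtain ⟨g, rfl⟩ := h
  rw [← DirectSum.decompose_of_mem_same (homogeneousSubmodule σ R) hf]
  exact DirectSum.coe_decompose_mul_of_left_mem_of_not_le _ hq hlt.not_ge

theorem finrank_le_of_forall_dvd {q : MvPolynomial (Fin 2) K} {e t : ℕ} (hq : q.IsHomogeneous e)
    {V : Submodule K (MvPolynomial (Fin 2) K)} (hV : ∀ f ∈ V, f.IsHomogeneous t ∧ q ∣ f) :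
    finrank K V ≤ t + 1 - e := by
  rcases lt_or_ge t e with hlt | hle
  · have : V = ⊥ := (Submodule.eq_bot_iff V).mpr fun f hf =>
      eq_zero_of_isHomogeneous_of_dvd hq (hV f hf).1 (hV f hf).2 hlt
    rw [this, finrank_bot]
    exact Nat.zero_le _
  · have hmul : V ≤ (homogeneousSubmodule (Fin 2) K (t - e)).map (LinearMap.mulLeft K q) := by
      intro f hf
      obtain ⟨hhom, hdvd⟩ := hV f hf
      rw [← Nat.add_sub_of_le hle] at hhom
      obtain ⟨g, hg, rfl⟩ := exists_isHomogeneous_eq_mul hq hhom hdvd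
      exact ⟨g, hg, rfl⟩
    calc finrank K V ≤ _ := Submodule.finrank_mono hmul
      _ ≤ finrank K (homogeneousSubmodule (Fin 2) K (t - e)) := Submodule.finrank_map_le _ _
      _ = t + 1 - e := by rw [finrank_homogeneousSubmodule, Nat.choose_one_right]; omega

theorem irreducible_linForm {σ : Type*} [Fintype σ] {c : σ → K} (hc : c ≠ 0) :
    Irreducible (linForm c) := by
  have hne : linForm c ≠ 0 := (map_ne_zero_iff _ linForm_injective).mpr hc
  refine irreducible_of_totalDegree_eq_one ((isHomogeneous_linForm c).totalDegree hne) ?_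
  intro r hr
  obtain ⟨d, hd⟩ := ne_zero_iff.mp hne
  exact (ne_zero_of_dvd_ne_zero hd (hr d)).isUnit

theorem exists_eq_smul_of_mul_eq_mul {x y : Fin 2 → K} (hy : y ≠ 0)
    (h : x 0 * y 1 = x 1 * y 0) : ∃ s : K, x = s • y := by
  obtain ⟨i, hi⟩ := Function.ne_iff.mp hy
  refine ⟨x i / y i, funext fun j => ?_⟩
  rw [Pi.smul_apply, smul_eq_mul, div_mul_eq_mul_div, eq_div_iff hi]
  fin_cases i <;> fin_cases j <;> simp_all

/-- The binary form vanishing exactly at the multiples of `x`. -/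
noncomputable def vanishingForm (x : Fin 2 → K) : MvPolynomial (Fin 2) K :=
  linForm ![x 1, -x 0]

theorem isHomogeneous_vanishingForm (x : Fin 2 → K) : (vanishingForm x).IsHomogeneous 1 :=
  isHomogeneous_linForm _

theorem irreducible_vanishingForm {x : Fin 2 → K} (hx : x ≠ 0) :
    Irreducible (vanishingForm x) := by
  refine irreducible_linForm fun h => hx ?_
  ext i
  fin_cases i
  · simpa using congrFun h 1
  · simpa using congrFun h 0

theorem vanishingForm_dvd_linForm {x c : Fin 2 → K} (hx : x ≠ 0) (hc : c ⬝ᵥ x = 0) :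
    vanishingForm x ∣ linForm c := by
  rw [dotProduct, Fin.sum_univ_two] at hc
  have hne : (![x 1, -x 0] : Fin 2 → K) ≠ 0 :=
    (map_ne_zero_iff _ linForm_injective).mp (irreducible_vanishingForm hx).ne_zero
  obtain ⟨s, hs⟩ := exists_eq_smul_of_mul_eq_mul (x := c) hne (by
    simp only [Matrix.cons_val_zero, Matrix.cons_val_one]
    linear_combination -hc)
  rw [hs, map_smul, smul_eq_C_mul]
  exact dvd_mul_left _ _

theorem exists_eq_smul_of_vanishingForm_dvd {x y : Fin 2 → K} (hy : y ≠ 0)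
    (h : vanishingForm x ∣ vanishingForm y) : ∃ s : K, x = s • y := by
  refine exists_eq_smul_of_mul_eq_mul hy ?_
  obtain ⟨g, hg⟩ := h
  have := congrArg (eval x) hg
  rw [vanishingForm, vanishingForm, map_mul, eval_linForm, eval_linForm] at this
  simp only [dotProduct, Fin.sum_univ_two, Matrix.cons_val_zero, Matrix.cons_val_one] at this
  linear_combination this

end BinaryForms

section RestrictionToLine

theorem mem_points_iff {L : Line K} {P : Plane K} : P ∈ L.points ↔ P.rep ∈ L.1 := by
  rw [Line.points, Set.mem_ofPred_eq, Projectivization.submodule_eq,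
    Submodule.span_singleton_le_iff_mem]

theorem exists_covector (L : Line K) :
    ∃ c : Fin 3 → K, c ≠ 0 ∧ ∀ x, x ∈ L.1 ↔ c ⬝ᵥ x = 0 := by
  have hlt : L.1 < ⊤ := by
    refine lt_top_iff_ne_top.mpr fun h => ?_
    have := L.2
    rw [h, finrank_top, finrank_fin_fun] at this
    omega
  obtain ⟨f, hf, hle⟩ := Submodule.exists_le_ker_of_lt_top _ hlt
  have hker : L.1 = LinearMap.ker f := by
    refine Submodule.eq_of_le_of_finrank_eq hle ?_
    have := f.finrank_range_add_finrank_ker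
    rw [LinearMap.range_eq_top.mpr (LinearMap.surjective hf), finrank_top, finrank_self,
      finrank_fin_fun] at this
    rw [L.2]
    omega
  obtain ⟨c, rfl⟩ := (dotProductEquiv K (Fin 3)).surjective f
  exact ⟨c, by simpa using hf, fun x => by rw [hker, LinearMap.mem_ker]; rfl⟩

/-- The coefficients of a linear equation of the line `L`. -/
noncomputable def covector (L : Line K) : Fin 3 → K := (exists_covector L).choose

theorem covector_ne_zero (L : Line K) : covector L ≠ 0 := (exists_covector L).choose_spec.1

theorem mem_iff_covector_dotProduct {L : Line K} {x : Fin 3 → K} :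
    x ∈ L.1 ↔ covector L ⬝ᵥ x = 0 := (exists_covector L).choose_spec.2 x

theorem mem_points_iff_covector {L : Line K} {P : Plane K} :
    P ∈ L.points ↔ covector L ⬝ᵥ P.rep = 0 :=
  mem_points_iff.trans mem_iff_covector_dotProduct

/-- A basis of the two-dimensional space underlying `L`, giving homogeneous coordinates on `L`. -/
noncomputable def lineBasis (L : Line K) : Basis (Fin 2) K L.1 := finBasisOfFinrankEq K L.1 L.2

/-- Restriction of polynomials to the line `L`, in the coordinates given by `lineBasis L`. -/
noncomputable def restrict (L : Line K) : MvPolynomial (Fin 3) K →ₐ[K] MvPolynomial (Fin 2) K :=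
  aeval fun i => linForm fun j => (lineBasis L j : Fin 3 → K) i

theorem restrict_linForm (L : Line K) (c : Fin 3 → K) :
    restrict L (linForm c) = linForm fun j => c ⬝ᵥ (lineBasis L j : Fin 3 → K) := by
  simp only [restrict, aeval_linForm, ← map_smul, ← map_sum]
  congr 1

theorem isHomogeneous_restrict (L : Line K) {f : MvPolynomial (Fin 3) K} {t : ℕ}
    (hf : f.IsHomogeneous t) : (restrict L f).IsHomogeneous t := by
  rw [← one_mul t]
  exact hf.aeval _ fun _ => isHomogeneous_linForm _

theorem covector_linForm_dvd_of_restrict_eq_zero {L : Line K} {f : MvPolynomial (Fin 3) K}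
    (hf : restrict L f = 0) : linForm (covector L) ∣ f := by
  obtain ⟨i, hi⟩ := Function.ne_iff.mp (covector_ne_zero L)
  set w : Fin 3 → K := Pi.single i (covector L i)⁻¹
  have hw : covector L ⬝ᵥ w = 1 := by simpa [w] using mul_inv_cancel₀ hi
  have hmem (k : Fin 3) : Pi.single k 1 - covector L k • w ∈ L.1 := by
    rw [mem_iff_covector_dotProduct]
    simp [dotProduct_sub, hw]
  -- A right inverse of the restriction up to multiples of the equation of `L`.
  let lift : MvPolynomial (Fin 2) K →ₐ[K] MvPolynomial (Fin 3) K :=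
    aeval fun j => linForm fun k => (lineBasis L).repr ⟨_, hmem k⟩ j
  set J := Ideal.span {linForm (covector L)}
  have hmk : Ideal.Quotient.mkₐ K J =
      (Ideal.Quotient.mkₐ K J).comp (lift.comp (restrict L)) := by
    ext k : 1
    rw [AlgHom.comp_apply, Ideal.Quotient.mkₐ_eq_mk, Ideal.Quotient.eq,
      Ideal.mem_span_singleton]
    refine ⟨C (w k), ?_⟩
    simp only [AlgHom.comp_apply, restrict, aeval_X, lift, aeval_linForm]
    rw [← one_mul (X k), ← C_1, ← linForm_single, mul_comm, ← smul_eq_C_mul, ← map_smul]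
    simp only [← map_smul, ← map_sum, ← map_sub]
    congr 1
    ext l
    have := congrFun (congrArg Subtype.val ((lineBasis L).sum_repr ⟨_, hmem l⟩)) k
    simp only [Fin.sum_univ_two, Submodule.coe_add, Submodule.coe_smul, Pi.add_apply,
      Pi.smul_apply, Pi.sub_apply, smul_eq_mul] at this ⊢
    rw [Pi.single_comm]
    linear_combination -this
  rw [← Ideal.mem_span_singleton, ← Ideal.Quotient.eq_zero_iff_mem, ← Ideal.Quotient.mkₐ_eq_mk K,
    hmk, AlgHom.comp_apply, AlgHom.comp_apply, hf, map_zero, map_zero]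

/-- Homogeneous coordinates on `L` of a point of `L`, with respect to `lineBasis L`
(`0` if the point is not on `L`). -/
noncomputable def lineCoord (L : Line K) (P : Plane K) : Fin 2 → K :=
  open scoped Classical in
  if h : P.rep ∈ L.1 then (lineBasis L).repr ⟨P.rep, h⟩ else 0

theorem rep_eq_sum_lineCoord {L : Line K} {P : Plane K} (hP : P ∈ L.points) :
    P.rep = ∑ j, lineCoord L P j • (lineBasis L j : Fin 3 → K) := by
  have h := mem_points_iff.mp hP
  rw [lineCoord, dif_pos h]
  simpa only [Submodule.coe_sum, Submodule.coe_smul] using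
    congrArg Subtype.val ((lineBasis L).sum_repr ⟨P.rep, h⟩).symm

theorem lineCoord_ne_zero {L : Line K} {P : Plane K} (hP : P ∈ L.points) :
    lineCoord L P ≠ 0 := by
  intro h
  apply P.rep_nonzero
  rw [rep_eq_sum_lineCoord hP, h]
  simp

theorem eq_of_lineCoord_eq_smul {L : Line K} {P Q : Plane K} (hP : P ∈ L.points)
    (hQ : Q ∈ L.points) {s : K} (h : lineCoord L P = s • lineCoord L Q) : P = Q := by
  rw [← P.mk_rep, ← Q.mk_rep, Projectivization.mk_eq_mk_iff']
  refine ⟨s, ?_⟩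
  rw [rep_eq_sum_lineCoord hP, rep_eq_sum_lineCoord hQ, h, Finset.smul_sum]
  simp only [Pi.smul_apply, smul_assoc]

theorem vanishingForm_pow_dvd_restrict {L : Line K} {P : Plane K} (hP : P ∈ L.points)
    {f : MvPolynomial (Fin 3) K} {m : ℕ} (hf : f ∈ pointIdeal P ^ m) :
    vanishingForm (lineCoord L P) ^ m ∣ restrict L f := by
  have hle : (pointIdeal P).map (restrict L) ≤
      Ideal.span {vanishingForm (lineCoord L P)} := by
    rw [Ideal.map_le_iff_le_comap, pointIdeal_eq_span_linForm, Ideal.span_le]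
    rintro _ ⟨c, hc, rfl⟩
    rw [SetLike.mem_coe, Ideal.mem_comap, Ideal.mem_span_singleton, restrict_linForm]
    refine vanishingForm_dvd_linForm (lineCoord_ne_zero hP) ?_
    rw [Set.mem_ofPred_eq, rep_eq_sum_lineCoord hP, dotProduct_sum] at hc
    rw [dotProduct_comm, ← hc]
    exact Finset.sum_congr rfl fun j _ => by rw [dotProduct_smul, smul_eq_mul]
  have hmem := Ideal.mem_map_of_mem (restrict L) hf
  rw [Ideal.map_pow] at hmem
  simpa only [Ideal.span_singleton_pow, Ideal.mem_span_singleton] using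
    Ideal.pow_right_mono hle m hmem

/-- The points of `X` on the line `L`. -/
noncomputable def onLine (X : Finset (Plane K)) (L : Line K) : Finset (Plane K) :=
  open scoped Classical in X.filter (· ∈ L.points)

theorem mem_onLine {X : Finset (Plane K)} {L : Line K} {P : Plane K} :
    P ∈ onLine X L ↔ P ∈ X ∧ P ∈ L.points := by
  simp only [onLine, Finset.mem_filter]

theorem prod_vanishingForm_pow_dvd_restrict {X : Finset (Plane K)} {μ : Plane K → ℕ}
    {f : MvPolynomial (Fin 3) K} (hf : f ∈ multIdeal X μ) (L : Line K) :
    ∏ P ∈ onLine X L, vanishingForm (lineCoord L P) ^ μ P ∣ restrict L f := by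
  refine Finset.prod_dvd_of_isRelPrime (fun P hP Q hQ hne => ?_) fun P hP => ?_
  · have hPL := (mem_onLine.mp hP).2
    have hQL := (mem_onLine.mp hQ).2
    refine IsRelPrime.pow ?_
    rw [(irreducible_vanishingForm (lineCoord_ne_zero hPL)).isRelPrime_iff_not_dvd]
    intro hdvd
    obtain ⟨s, hs⟩ := exists_eq_smul_of_vanishingForm_dvd (lineCoord_ne_zero hQL) hdvd
    exact hne (eq_of_lineCoord_eq_smul hPL hQL hs)
  · obtain ⟨hPX, hPL⟩ := mem_onLine.mp hP
    exact vanishingForm_pow_dvd_restrict hPL (mem_multIdeal.mp hf P hPX)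

theorem finrank_gradedPart_le_add (X : Finset (Plane K)) (μ : Plane K → ℕ) (L : Line K)
    (t : ℕ) :
    finrank K (gradedPart (multIdeal X μ) t) ≤
      finrank K ↥(gradedPart (multIdeal X μ) t ⊓ LinearMap.ker (restrict L).toLinearMap) +
        (t + 1 - ∑ P ∈ onLine X L, μ P) := by
  set V := gradedPart (multIdeal X μ) t
  let ρ := (restrict L).toLinearMap.domRestrict V
  have hhom : (∏ P ∈ onLine X L, vanishingForm (lineCoord L P) ^ μ P).IsHomogeneous
      (∑ P ∈ onLine X L, μ P) :=
    IsHomogeneous.prod _ _ _ fun P _ => by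
      simpa only [one_mul] using (isHomogeneous_vanishingForm _).pow (μ P)
  have hrange : finrank K (LinearMap.range ρ) ≤ t + 1 - ∑ P ∈ onLine X L, μ P := by
    refine finrank_le_of_forall_dvd hhom ?_
    rintro _ ⟨⟨f, hf⟩, rfl⟩
    obtain ⟨hft, hfI⟩ := mem_gradedPart.mp hf
    exact ⟨isHomogeneous_restrict L hft, prod_vanishingForm_pow_dvd_restrict hfI L⟩
  have hker : finrank K (LinearMap.ker ρ) =
      finrank K ↥(V ⊓ LinearMap.ker (restrict L).toLinearMap) := by
    rw [← Submodule.finrank_map_subtype_eq, LinearMap.ker_domRestrict,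
      Submodule.map_comap_subtype]
  rw [← ρ.finrank_range_add_finrank_ker, hker]
  omega

end RestrictionToLine

section Defect

/-- The multiplicities `μ`, lowered by one at the points of the line `L`. -/
noncomputable def reduce (μ : Plane K → ℕ) (L : Line K) (P : Plane K) : ℕ :=
  open scoped Classical in if P ∈ L.points then μ P - 1 else μ P

theorem linForm_covector_mul_mem_multIdeal_iff {X : Finset (Plane K)} {μ : Plane K → ℕ}
    {L : Line K} {g : MvPolynomial (Fin 3) K} :
    linForm (covector L) * g ∈ multIdeal X μ ↔ g ∈ multIdeal X (reduce μ L) := by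
  simp only [mem_multIdeal]
  refine forall₂_congr fun P _ => ?_
  by_cases hP : P ∈ L.points
  · have h0 := mem_points_iff_covector.mp hP
    rw [reduce, if_pos hP]
    refine ⟨mem_pow_pred_of_linForm_mul_mem_pow (covector_ne_zero L) h0, fun hg => ?_⟩
    have hmul := Ideal.mul_mem_mul (linForm_mem_pointIdeal h0) hg
    rw [← pow_succ'] at hmul
    exact Ideal.pow_le_pow_right (by omega) hmul
  · rw [reduce, if_neg hP]
    refine ⟨mem_pow_of_mul_mem_pow ?_, Ideal.mul_mem_left _ _⟩
    rwa [eval_linForm, ne_eq, ← mem_points_iff_covector]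

/-- The dimension of the degree `n - 1` part of `I`. The index is shifted by one so that degree
`-1` is covered; peeling off a line may start in degree `0`. -/
noncomputable def numForms (I : Ideal (MvPolynomial (Fin 3) K)) : ℕ → ℕ
  | 0 => 0
  | n + 1 => finrank K (gradedPart I n)

theorem numForms_succ_le (X : Finset (Plane K)) (μ : Plane K → ℕ) (L : Line K) (n : ℕ) :
    numForms (multIdeal X μ) (n + 1) ≤
      numForms (multIdeal X (reduce μ L)) n + (n + 1 - ∑ P ∈ onLine X L, μ P) := by
  refine (finrank_gradedPart_le_add X μ L n).trans (Nat.add_le_add_right ?_ _)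
  rcases n with _ | n
  · refine (Submodule.finrank_eq_zero.mpr ?_).le
    rw [Submodule.eq_bot_iff]
    rintro f ⟨hf, hker⟩
    exact eq_zero_of_isHomogeneous_of_dvd (isHomogeneous_linForm _) (mem_gradedPart.mp hf).1
      (covector_linForm_dvd_of_restrict_eq_zero hker) one_pos
  · refine (Submodule.finrank_mono ?_).trans (Submodule.finrank_map_le
      (LinearMap.mulLeft K (linForm (covector L))) (gradedPart (multIdeal X (reduce μ L)) n))
    rintro f ⟨hf, hker⟩
    obtain ⟨hhom, hmem⟩ := mem_gradedPart.mp hf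
    rw [add_comm] at hhom
    obtain ⟨g, hg, rfl⟩ := exists_isHomogeneous_eq_mul (isHomogeneous_linForm _) hhom
      (covector_linForm_dvd_of_restrict_eq_zero hker)
    exact ⟨g, mem_gradedPart.mpr ⟨hg, linForm_covector_mul_mem_multIdeal_iff.mp hmem⟩, rfl⟩

theorem numForms_reduce_le (X : Finset (Plane K)) (μ : Plane K → ℕ) (L : Line K) (n : ℕ) :
    numForms (multIdeal X (reduce μ L)) n ≤ numForms (multIdeal X μ) (n + 1) := by
  rcases n with _ | n
  · exact Nat.zero_le _
  have hinj : Function.Injective (LinearMap.mulLeft K (linForm (covector L))) :=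
    fun _ _ h => mul_left_cancel₀
      ((map_ne_zero_iff _ linForm_injective).mpr (covector_ne_zero L)) h
  rw [numForms, (Submodule.equivMapOfInjective _ hinj _).finrank_eq]
  refine Submodule.finrank_mono ?_
  rintro _ ⟨g, hg, rfl⟩
  obtain ⟨hhom, hmem⟩ := mem_gradedPart.mp hg
  refine mem_gradedPart.mpr ⟨?_, linForm_covector_mul_mem_multIdeal_iff.mpr hmem⟩
  rw [add_comm]
  exact (isHomogeneous_linForm _).mul hhom

/-- The degree of the fat point scheme with multiplicities `μ`: the number of linear conditions
that it imposes on forms of large degree. -/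
def fatDegree (X : Finset (Plane K)) (μ : Plane K → ℕ) : ℕ := ∑ P ∈ X, (μ P + 1).choose 2

theorem fatDegree_eq_add_reduce (X : Finset (Plane K)) (μ : Plane K → ℕ) (L : Line K) :
    fatDegree X μ = fatDegree X (reduce μ L) + ∑ P ∈ onLine X L, μ P := by
  rw [onLine, Finset.sum_filter, fatDegree, fatDegree, ← Finset.sum_add_distrib]
  refine Finset.sum_congr rfl fun P _ => ?_
  by_cases h : P ∈ L.points
  · rw [reduce, if_pos h, if_pos h]
    rcases μ P with _ | k
    · rfl
    · rw [Nat.add_sub_cancel, Nat.choose_succ_succ' (k + 1) 1, Nat.choose_one_right, add_comm]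
  · rw [reduce, if_neg h, if_neg h, add_zero]

/-- The failure of the fat point scheme with multiplicities `μ` to impose independent conditions
on forms of degree `n - 1`: its degree minus its Hilbert function in degree `n - 1`. -/
noncomputable def defect (X : Finset (Plane K)) (μ : Plane K → ℕ) (n : ℕ) : ℤ :=
  fatDegree X μ + numForms (multIdeal X μ) n - (n + 1).choose 2

theorem defect_nonneg (X : Finset (Plane K)) (μ : Plane K → ℕ) (n : ℕ) : 0 ≤ defect X μ n := by
  rcases n with _ | n
  · simp [defect, numForms]
  · have := finrank_le_gradedPart_multIdeal X μ n
    rw [finrank_homogeneousSubmodule 2 n] at this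
    simp only [defect, numForms, fatDegree, add_assoc, Nat.reduceAdd]
    omega

theorem defect_succ_le {X : Finset (Plane K)} {μ : Plane K → ℕ} {L : Line K} {n : ℕ}
    (h : ∑ P ∈ onLine X L, μ P ≤ n + 1) : defect X μ (n + 1) ≤ defect X (reduce μ L) n := by
  have hdeg := fatDegree_eq_add_reduce X μ L
  have hforms := numForms_succ_le X μ L n
  have hchoose : (n + 1 + 1).choose 2 = (n + 1).choose 2 + (n + 1) := by
    rw [Nat.choose_succ_succ' (n + 1) 1, Nat.choose_one_right, add_comm]
  simp only [defect]
  omega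

theorem defect_succ_eq {X : Finset (Plane K)} {μ : Plane K → ℕ} {L : Line K} {n : ℕ}
    (h : ∑ P ∈ onLine X L, μ P = n + 2) : defect X μ (n + 1) = defect X (reduce μ L) n + 1 := by
  have hdeg := fatDegree_eq_add_reduce X μ L
  have hle := numForms_succ_le X μ L n
  have hge := numForms_reduce_le X μ L n
  have hchoose : (n + 1 + 1).choose 2 = (n + 1).choose 2 + (n + 1) := by
    rw [Nat.choose_succ_succ' (n + 1) 1, Nat.choose_one_right, add_comm]
  simp only [defect]
  omega

theorem defect_eq_zero_of_forall_eq_zero {X : Finset (Plane K)} {μ : Plane K → ℕ}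
    (h : ∀ P ∈ X, μ P = 0) (n : ℕ) : defect X μ n = 0 := by
  have hdeg : fatDegree X μ = 0 := Finset.sum_eq_zero fun P hP => by rw [h P hP]; rfl
  have hforms : numForms (multIdeal X μ) n = (n + 1).choose 2 := by
    rcases n with _ | n
    · rfl
    have htop : gradedPart (multIdeal X μ) n = homogeneousSubmodule (Fin 3) K n := by
      ext f
      rw [mem_gradedPart, mem_multIdeal, mem_homogeneousSubmodule, and_iff_left]
      intro P hP
      rw [h P hP, pow_zero, Ideal.one_eq_top]
      trivial
    rw [numForms, htop, finrank_homogeneousSubmodule 2 n]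
  rw [defect, hdeg, hforms, Nat.cast_zero, zero_add, sub_self]

theorem firstDifference_hilbertFunction_fatIdeal (m : ℕ) (X : Finset (Plane K)) (t : ℕ) :
    firstDifference (hilbertFunction (fatIdeal m X)) t =
      defect X (fun _ => m) t - defect X (fun _ => m) (t + 1) := by
  have hdim (n : ℕ) := finrank_homogeneousSubmodule (K := K) 2 n
  have hideal : fatIdeal m X = multIdeal X fun _ => m := rfl
  rw [hideal]
  rcases t with _ | t
  · simp only [firstDifference, hilbertFunction, hdim 0, defect, numForms, zero_add,
      Nat.choose_self, Nat.choose_succ_self 1, Nat.cast_zero, Nat.cast_one]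
    ring
  · simp only [firstDifference, hilbertFunction, hdim, defect, numForms]
    ring

end Defect

section Lines

theorem finrank_submodule_sup_submodule {P Q : Plane K} (h : P ≠ Q) :
    finrank K (P.submodule ⊔ Q.submodule : Submodule K (Fin 3 → K)) = 2 := by
  have hsum := Submodule.finrank_sup_add_finrank_inf_eq P.submodule Q.submodule
  have hle := Submodule.finrank_mono (inf_le_left : P.submodule ⊓ Q.submodule ≤ P.submodule)
  rw [P.finrank_submodule] at hsum hle
  rw [Q.finrank_submodule] at hsum
  have hne : finrank K (P.submodule ⊓ Q.submodule : Submodule K (Fin 3 → K)) ≠ 1 := by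
    intro hone
    have hP := Submodule.eq_of_le_of_finrank_eq inf_le_left (hone.trans P.finrank_submodule.symm)
    have hQ := Submodule.eq_of_le_of_finrank_eq inf_le_right (hone.trans Q.finrank_submodule.symm)
    exact h (Projectivization.submodule_injective (hP.symm.trans hQ))
  omega

/-- The line through two distinct points. -/
def lineThrough {P Q : Plane K} (h : P ≠ Q) : Line K :=
  ⟨P.submodule ⊔ Q.submodule, finrank_submodule_sup_submodule h⟩

theorem left_mem_lineThrough {P Q : Plane K} (h : P ≠ Q) : P ∈ (lineThrough h).points :=
  le_sup_left (a := P.submodule)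

theorem right_mem_lineThrough {P Q : Plane K} (h : P ≠ Q) : Q ∈ (lineThrough h).points :=
  le_sup_right (a := P.submodule)

theorem eq_lineThrough {P Q : Plane K} (h : P ≠ Q) {L : Line K} (hP : P ∈ L.points)
    (hQ : Q ∈ L.points) : L = lineThrough h :=
  Subtype.ext (Submodule.eq_of_le_of_finrank_eq (sup_le hP hQ)
    ((finrank_submodule_sup_submodule h).trans L.2.symm)).symm

theorem line_eq_of_mem {P Q : Plane K} (h : P ≠ Q) {L M : Line K} (hPL : P ∈ L.points)
    (hQL : Q ∈ L.points) (hPM : P ∈ M.points) (hQM : Q ∈ M.points) : L = M :=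
  (eq_lineThrough h hPL hQL).trans (eq_lineThrough h hPM hQM).symm

theorem card_onLine_onLine_le_one (X : Finset (Plane K)) {L M : Line K} (h : L ≠ M) :
    (onLine (onLine X L) M).card ≤ 1 := by
  rw [Finset.card_le_one]
  intro P hP Q hQ
  by_contra hne
  simp only [mem_onLine] at hP hQ
  exact h (line_eq_of_mem hne hP.1.2 hQ.1.2 hP.2 hQ.2)

theorem onLine_subset (X : Finset (Plane K)) (L : Line K) : onLine X L ⊆ X :=
  fun _ hP => (mem_onLine.mp hP).1

theorem mem_linesWithExactly_iff {X : Finset (Plane K)} {n : ℕ} {L : Line K} :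
    L ∈ linesWithExactly X n ↔ (onLine X L).card = n := by
  rw [linesWithExactly, Set.mem_ofPred_eq, ← Set.ncard_coe_finset]
  congr!
  ext P
  simp [mem_onLine]

theorem linesWithExactly_finite (X : Finset (Plane K)) {n : ℕ} (hn : 2 ≤ n) :
    (linesWithExactly X n).Finite := by
  refine Set.Finite.of_finite_image (f := onLine X) (X.powerset.finite_toSet.subset ?_) ?_
  · rintro _ ⟨L, -, rfl⟩
    exact Finset.mem_coe.mpr (Finset.mem_powerset.mpr (onLine_subset X L))
  · intro L hL M _ hLM
    rw [mem_linesWithExactly_iff] at hL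
    obtain ⟨P, hP, Q, hQ, hne⟩ := Finset.one_lt_card.mp (hL ▸ hn : 1 < (onLine X L).card)
    have hP' := mem_onLine.mp (hLM ▸ hP)
    have hQ' := mem_onLine.mp (hLM ▸ hQ)
    exact line_eq_of_mem hne (mem_onLine.mp hP).2 (mem_onLine.mp hQ).2 hP'.2 hQ'.2

end Lines

section Peeling

/-- The number of lines of the list `l` through `P`. -/
noncomputable def through (l : List (Line K)) (P : Plane K) : ℕ :=
  open scoped Classical in l.countP (P ∈ Line.points ·)

theorem through_cons (L : Line K) (l : List (Line K)) (P : Plane K) :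
    through (L :: l) P = through l P + open scoped Classical in if P ∈ L.points then 1 else 0 := by
  by_cases h : P ∈ L.points <;> simp [through, h]

theorem through_append (l₁ l₂ : List (Line K)) (P : Plane K) :
    through (l₁ ++ l₂) P = through l₁ P + through l₂ P := List.countP_append

theorem through_le_length (l : List (Line K)) (P : Plane K) : through l P ≤ l.length :=
  List.countP_le_length

theorem through_pos {l : List (Line K)} {L : Line K} {P : Plane K} (hL : L ∈ l)
    (hP : P ∈ L.points) : 0 < through l P :=
  List.countP_pos_iff.mpr ⟨L, hL, by simpa using hP⟩

theorem through_toList (A : Finset (Line K)) (P : Plane K) :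
    through A.toList P = open scoped Classical in (A.filter (P ∈ Line.points ·)).card := by
  classical
  rw [through, ← Multiset.coe_countP, Finset.coe_toList, Multiset.countP_eq_card_filter]
  simp only [Finset.card, Finset.filter_val]

theorem sum_through (X : Finset (Plane K)) (L : Line K) (l : List (Line K)) :
    ∑ P ∈ onLine X L, through l P = (l.map fun M => (onLine (onLine X L) M).card).sum := by
  induction l with
  | nil => simp [through]
  | cons M l ih =>
    simp only [through_cons, Finset.sum_add_distrib, ih, List.map_cons, List.sum_cons]
    rw [add_comm, Finset.sum_boole, Nat.cast_id]
    rfl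

/-- The multiplicities remaining after peeling off the lines of `l`, lowering the multiplicity of
a point by one for each line through it (but not below `0`). -/
noncomputable def peel (μ : Plane K → ℕ) (l : List (Line K)) (P : Plane K) : ℕ :=
  μ P - through l P

theorem peel_append (μ : Plane K → ℕ) (l₁ l₂ : List (Line K)) :
    peel μ (l₁ ++ l₂) = peel (peel μ l₁) l₂ := by
  ext P
  simp only [peel, through_append, Nat.sub_add_eq]

theorem peel_cons (μ : Plane K → ℕ) (L : Line K) (l : List (Line K)) :
    peel μ (L :: l) = peel (reduce μ L) l := by
  ext P
  by_cases h : P ∈ L.points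
  · simp only [peel, through_cons, reduce, h, if_true]
    omega
  · simp only [peel, through_cons, reduce, h, if_false, add_zero]

theorem sum_peel_const {X : Finset (Plane K)} {L : Line K} {l : List (Line K)} {m : ℕ}
    (h : ∀ P ∈ onLine X L, through l P ≤ m) :
    (∑ P ∈ onLine X L, peel (fun _ => m) l P) +
      (l.map fun M => (onLine (onLine X L) M).card).sum = m * (onLine X L).card := by
  rw [← sum_through, ← Finset.sum_add_distrib, mul_comm, ← smul_eq_mul, ← Finset.sum_const]
  exact Finset.sum_congr rfl fun P hP => Nat.sub_add_cancel (h P hP)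

theorem sum_peel_const_le (X : Finset (Plane K)) (L : Line K) (l : List (Line K)) (c : ℕ) :
    ∑ P ∈ onLine X L, peel (fun _ => c + 1) l P ≤
      c * (onLine X L).card + ((onLine X L).filter fun P => through l P = 0).card := by
  rw [Finset.card_filter, mul_comm, ← smul_eq_mul, ← Finset.sum_const, ← Finset.sum_add_distrib]
  refine Finset.sum_le_sum fun P _ => ?_
  rw [peel]
  split_ifs <;> omega

theorem defect_le_peel {X : Finset (Plane K)} {μ : Plane K → ℕ} {n : ℕ} (l : List (Line K))
    (h : ∀ l₁ L l₂, l = l₁ ++ L :: l₂ → ∑ P ∈ onLine X L, peel μ l₁ P ≤ n + l₂.length + 1) :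
    defect X μ (n + l.length) ≤ defect X (peel μ l) n := by
  induction l generalizing μ with
  | nil => rfl
  | cons L l ih =>
    rw [peel_cons, List.length_cons, ← add_assoc]
    refine (defect_succ_le (μ := μ) (L := L) (h [] L l rfl)).trans (ih fun l₁ M l₂ hl => ?_)
    simpa only [peel_cons] using h (L :: l₁) M l₂ (congrArg (L :: ·) hl)

theorem defect_eq_peel {X : Finset (Plane K)} {μ : Plane K → ℕ} {n : ℕ} (l : List (Line K))
    (h : ∀ l₁ L l₂, l = l₁ ++ L :: l₂ → ∑ P ∈ onLine X L, peel μ l₁ P = n + l₂.length + 2) :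
    defect X μ (n + l.length) = defect X (peel μ l) n + l.length := by
  induction l generalizing μ with
  | nil => exact (add_zero _).symm
  | cons L l ih =>
    rw [peel_cons, List.length_cons, ← add_assoc, defect_succ_eq (μ := μ) (L := L) (h [] L l rfl),
      ih fun l₁ M l₂ hl => ?_]
    · push_cast
      ring
    · simpa only [peel_cons] using h (L :: l₁) M l₂ (congrArg (L :: ·) hl)

end Peeling

/-- The data of a `𝕜`-configuration of type `d`, with at least one line: `Y i` and `L i` are the
subsets and lines called `𝕏ᵢ₊₁` and `𝕃ᵢ₊₁` in the definition of a `𝕜`-configuration. -/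
structure Configuration (X : Finset (Plane K)) {n : ℕ} (d : Fin (n + 1) → ℕ)
    (Y : Fin (n + 1) → Finset (Plane K)) (L : Fin (n + 1) → Line K) : Prop where
  one_le : ∀ i, 1 ≤ d i
  strictMono : StrictMono d
  injective : Function.Injective L
  mem_iff : ∀ P, P ∈ X ↔ ∃ i, P ∈ Y i
  card : ∀ i, (Y i).card = d i
  mem_points : ∀ {i P}, P ∈ Y i → P ∈ (L i).points
  notMem_points : ∀ {i j P}, j < i → P ∈ Y j → P ∉ (L i).points

theorem IsKConfiguration.exists_configuration {X : Finset (Plane K)} {n : ℕ}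
    {d : Fin (n + 1) → ℕ} (h : IsKConfiguration X d) : ∃ Y L, Configuration X d Y L := by
  obtain ⟨hpos, hmono, Y, L, hinj, hcover, hY, hsep⟩ := h
  refine ⟨Y, L, hpos, hmono, hinj, fun P => ?_, fun i => (hY i).1, fun hP => (hY _).2 hP,
    fun hji hP => hsep _ _ hji _ hP⟩
  rw [← Finset.mem_coe, hcover]
  simp only [Set.mem_iUnion, Finset.mem_coe]

open scoped Classical in
/-- The indices after `a` of the sets `Y j` having no point on the line `M`. -/
noncomputable def missing {n : ℕ} (Y : Fin (n + 1) → Finset (Plane K)) (M : Line K)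
    (a : Fin (n + 1)) : Finset (Fin (n + 1)) :=
  (Finset.Ioi a).filter fun j => onLine (Y j) M = ∅

theorem mem_missing {n : ℕ} {Y : Fin (n + 1) → Finset (Plane K)} {M : Line K}
    {a j : Fin (n + 1)} : j ∈ missing Y M a ↔ a < j ∧ onLine (Y j) M = ∅ := by
  simp only [missing, Finset.mem_filter, Finset.mem_Ioi]

/-- The lines `L j` with `j ∈ S`, in decreasing order of `j`. -/
def descending {n : ℕ} (L : Fin (n + 1) → Line K) (S : Finset (Fin (n + 1))) : List (Line K) :=
  (S.sort (· ≥ ·)).map L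

section Descending

variable {n : ℕ} {L : Fin (n + 1) → Line K}

theorem mem_descending {S : Finset (Fin (n + 1))} {M : Line K} :
    M ∈ descending L S ↔ ∃ j ∈ S, L j = M := by
  simp only [descending, List.mem_map, Finset.mem_sort]

theorem length_descending (L : Fin (n + 1) → Line K) (S : Finset (Fin (n + 1))) :
    (descending L S).length = S.card := by
  rw [descending, List.length_map, Finset.length_sort]

theorem descending_eq_append {S : Finset (Fin (n + 1))} (hS : IsUpperSet (S : Set (Fin (n + 1))))
    {l₁ l₂ : List (Line K)} {M : Line K} (h : descending L S = l₁ ++ M :: l₂) :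
    ∃ a ∈ S, M = L a ∧ l₁ = descending L (Finset.Ioi a) := by
  rw [descending, List.map_eq_append_iff] at h
  obtain ⟨q₁, q', hq, rfl, hq'⟩ := h
  rw [List.map_eq_cons_iff] at hq'
  obtain ⟨a, q₂, rfl, rfl, -⟩ := hq'
  have hmem (j : Fin (n + 1)) : j ∈ S ↔ j ∈ q₁ ++ a :: q₂ := by rw [← hq, Finset.mem_sort]
  have hpair : (q₁ ++ a :: q₂).Pairwise (· > ·) := hq ▸ (Finset.sortedGT_sort S).pairwise
  rw [List.pairwise_append, List.pairwise_cons] at hpair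
  obtain ⟨hq₁, ⟨haq₂, -⟩, hq₁a⟩ := hpair
  have haS : a ∈ S := (hmem a).mpr (by simp)
  have hIoi : q₁.toFinset = Finset.Ioi a := by
    ext j
    rw [List.mem_toFinset, Finset.mem_Ioi]
    refine ⟨fun hj => hq₁a j hj a List.mem_cons_self, fun hj => ?_⟩
    have := (hmem j).mp (hS hj.le haS)
    rw [List.mem_append, List.mem_cons] at this
    exact this.resolve_right fun hj' => hj'.elim hj.ne' fun hj' => (haq₂ j hj').not_gt hj
  refine ⟨a, haS, rfl, ?_⟩
  rw [descending, ← hIoi, (List.toFinset_sort _ (hq₁.imp ne_of_gt)).mpr (hq₁.imp le_of_lt)]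

end Descending

/-- The index `a` from which on the line `M` can contain points of the sets `Y j`, and after which
it is not one of the lines `L j`. -/
structure HasLevel {n : ℕ} (Y : Fin (n + 1) → Finset (Plane K)) (L : Fin (n + 1) → Line K)
    (M : Line K) (a : Fin (n + 1)) : Prop where
  onLine_eq_empty : ∀ j < a, onLine (Y j) M = ∅
  ne : ∀ j, a < j → M ≠ L j

namespace Configuration

variable {X : Finset (Plane K)} {n : ℕ} {d : Fin (n + 1) → ℕ}
  {Y : Fin (n + 1) → Finset (Plane K)} {L : Fin (n + 1) → Line K}

theorem subset (h : Configuration X d Y L) (i : Fin (n + 1)) : Y i ⊆ X :=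
  fun P hP => (h.mem_iff P).mpr ⟨i, hP⟩

theorem le_of_mem_points (h : Configuration X d Y L) {i j : Fin (n + 1)} {P : Plane K}
    (hP : P ∈ Y j) (hPi : P ∈ (L i).points) : i ≤ j :=
  not_lt.mp fun hji => h.notMem_points hji hP hPi

theorem index_unique (h : Configuration X d Y L) {i j : Fin (n + 1)} {P : Plane K}
    (hi : P ∈ Y i) (hj : P ∈ Y j) : i = j :=
  (h.le_of_mem_points hj (h.mem_points hi)).antisymm (h.le_of_mem_points hi (h.mem_points hj))

theorem card_onLine_Y_le_one (h : Configuration X d Y L) {M : Line K} {j : Fin (n + 1)}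
    (hM : M ≠ L j) : (onLine (Y j) M).card ≤ 1 := by
  refine (Finset.card_le_card fun P hP => ?_).trans (card_onLine_onLine_le_one (Y j) hM.symm)
  rw [mem_onLine] at hP
  exact mem_onLine.mpr ⟨mem_onLine.mpr ⟨hP.1, h.mem_points hP.1⟩, hP.2⟩

theorem card_onLine_eq_sum (h : Configuration X d Y L) (M : Line K) :
    (onLine X M).card = ∑ j, (onLine (Y j) M).card := by
  classical
  have hunion : onLine X M = Finset.univ.biUnion fun j => onLine (Y j) M := by
    ext P
    simp only [mem_onLine, h.mem_iff, Finset.mem_biUnion, Finset.mem_univ, true_and,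
      exists_and_right]
  rw [hunion, Finset.card_biUnion]
  intro i _ j _ hij
  exact Finset.disjoint_left.mpr fun P hi hj => hij
    (h.index_unique (mem_onLine.mp hi).1 (mem_onLine.mp hj).1)

theorem hasLevel (h : Configuration X d Y L) (a : Fin (n + 1)) : HasLevel Y L (L a) a where
  onLine_eq_empty _ hj := Finset.eq_empty_of_forall_notMem fun _ hP =>
    h.notMem_points hj (mem_onLine.mp hP).1 (mem_onLine.mp hP).2
  ne _ hj e := hj.ne (h.injective e)

theorem exists_hasLevel (h : Configuration X d Y L) (M : Line K) :
    ∃ a, HasLevel Y L M a ∧ (M = L a ∨ a = 0 ∧ M ∉ Set.range L) := by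
  by_cases hM : M ∈ Set.range L
  · obtain ⟨a, rfl⟩ := hM
    exact ⟨a, h.hasLevel a, Or.inl rfl⟩
  · exact ⟨0, ⟨fun j hj => absurd hj (Fin.not_lt_zero j), fun j _ e => hM ⟨j, e.symm⟩⟩,
      Or.inr ⟨rfl, hM⟩⟩

theorem card_onLine_add (h : Configuration X d Y L) {M : Line K} {a : Fin (n + 1)}
    (ha : HasLevel Y L M a) :
    (onLine X M).card + (missing Y M a).card + a = (onLine (Y a) M).card + n := by
  have hterm (j : Fin (n + 1)) :
      (onLine (Y j) M).card + (if j ∈ missing Y M a then 1 else 0) + (if j < a then 1 else 0) =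
        (if j = a then (onLine (Y a) M).card else 0) + if j ≠ a then 1 else 0 := by
    rcases lt_trichotomy j a with hj | rfl | hj
    · simp [mem_missing, ha.onLine_eq_empty j hj, hj, hj.ne, hj.le]
    · simp [mem_missing]
    · have hle := h.card_onLine_Y_le_one (ha.ne j hj)
      by_cases hempty : onLine (Y j) M = ∅
      · simp [mem_missing, hempty, hj, hj.ne', hj.le]
      · have := Finset.card_pos.mpr (Finset.nonempty_iff_ne_empty.mpr hempty)
        simp only [mem_missing, hempty, and_false, if_false, hj.not_gt, hj.ne', ne_eq,
          not_false_eq_true, if_true]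
        omega
  have hsum := Finset.sum_congr rfl fun j (_ : j ∈ Finset.univ) => hterm j
  simp only [Finset.sum_add_distrib, ← h.card_onLine_eq_sum, Finset.sum_ite_eq', Finset.mem_univ,
    if_true, Finset.sum_boole, Nat.cast_id, Finset.filter_mem_eq_inter, Finset.univ_inter,
    Finset.filter_ne', Finset.card_erase_of_mem, Finset.card_univ, Fintype.card_fin,
    Finset.filter_gt_eq_Iio, Fin.card_Iio] at hsum
  simpa using hsum

theorem d_add_le (h : Configuration X d Y L) (a : Fin (n + 1)) :
    d a + n ≤ d (Fin.last n) + a := by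
  induction a using Fin.reverseInduction with
  | last => rfl
  | cast i ih =>
    have := h.strictMono i.castSucc_lt_succ
    simp only [Fin.val_succ, Fin.val_castSucc] at ih ⊢
    omega

theorem succ_le_top (h : Configuration X d Y L) : n + 1 ≤ d (Fin.last n) := by
  have := h.d_add_le 0
  have := h.one_le 0
  rw [Fin.val_zero] at *
  omega

theorem card_onLine_Y_le (h : Configuration X d Y L) (M : Line K) (a : Fin (n + 1)) :
    (onLine (Y a) M).card ≤ d a :=
  h.card a ▸ Finset.card_le_card (onLine_subset _ _)

theorem card_onLine_le_top (h : Configuration X d Y L) (M : Line K) :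
    (onLine X M).card ≤ d (Fin.last n) := by
  obtain ⟨a, ha, -⟩ := h.exists_hasLevel M
  have := h.card_onLine_add ha
  have := h.card_onLine_Y_le M a
  have := h.d_add_le a
  omega

theorem card_onLine_last (h : Configuration X d Y L) :
    (onLine X (L (Fin.last n))).card = d (Fin.last n) := by
  refine (h.card_onLine_le_top _).antisymm ?_
  rw [← h.card]
  exact Finset.card_le_card fun P hP => mem_onLine.mpr ⟨h.subset _ hP, h.mem_points hP⟩

section FullLines

variable {M N : Line K} {a : Fin (n + 1)}

theorem missing_eq_empty_of_full (h : Configuration X d Y L) (ha : HasLevel Y L M a)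
    (hM : (onLine X M).card = d (Fin.last n)) : missing Y M a = ∅ := by
  have := h.card_onLine_add ha
  have := h.card_onLine_Y_le M a
  have := h.d_add_le a
  exact Finset.card_eq_zero.mp (by omega)

theorem mem_points_of_full (h : Configuration X d Y L) (ha : HasLevel Y L M a)
    (hM : (onLine X M).card = d (Fin.last n)) {P : Plane K} (hP : P ∈ Y a) : P ∈ M.points := by
  have hcard := h.card_onLine_add ha
  have := h.card_onLine_Y_le M a
  have := h.d_add_le a
  have heq := Finset.eq_of_subset_of_card_le (onLine_subset (Y a) M) (by rw [h.card]; omega)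
  exact (mem_onLine.mp (heq ▸ hP)).2

theorem exists_mem_of_full (h : Configuration X d Y L) (ha : HasLevel Y L M a)
    (hM : (onLine X M).card = d (Fin.last n)) {j : Fin (n + 1)} (hj : a ≤ j) :
    ∃ P ∈ Y j, P ∈ M.points := by
  rcases hj.eq_or_lt with rfl | hj
  · obtain ⟨P, hP⟩ := Finset.card_pos.mp (h.card a ▸ h.one_le a : 0 < (Y a).card)
    exact ⟨P, hP, h.mem_points_of_full ha hM hP⟩
  by_contra! hnone
  have hmem : j ∈ missing Y M a := mem_missing.mpr ⟨hj,
    Finset.eq_empty_of_forall_notMem fun P hP =>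
      hnone P (mem_onLine.mp hP).1 (mem_onLine.mp hP).2⟩
  rw [h.missing_eq_empty_of_full ha hM] at hmem
  exact Finset.notMem_empty _ hmem

theorem exists_mem_inter_of_full (h : Configuration X d Y L) {b : Fin (n + 1)}
    (ha : HasLevel Y L M a) (hb : HasLevel Y L N b) (hab : a ≤ b)
    (hM : (onLine X M).card = d (Fin.last n)) (hN : (onLine X N).card = d (Fin.last n)) :
    ∃ P ∈ Y b, P ∈ M.points ∧ P ∈ N.points := by
  obtain ⟨P, hP, hPM⟩ := h.exists_mem_of_full ha hM hab
  exact ⟨P, hP, hPM, h.mem_points_of_full hb hN hP⟩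

theorem card_onLine_onLine_of_full (h : Configuration X d Y L) (hMN : M ≠ N)
    (hM : (onLine X M).card = d (Fin.last n)) (hN : (onLine X N).card = d (Fin.last n)) :
    (onLine (onLine X M) N).card = 1 := by
  refine (card_onLine_onLine_le_one X hMN).antisymm (Finset.card_pos.mpr ?_)
  obtain ⟨a, ha, -⟩ := h.exists_hasLevel M
  obtain ⟨b, hb, -⟩ := h.exists_hasLevel N
  obtain ⟨j, P, hP, hPM, hPN⟩ : ∃ j, ∃ P ∈ Y j, P ∈ M.points ∧ P ∈ N.points := by
    rcases le_total a b with hab | hba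
    · exact ⟨b, h.exists_mem_inter_of_full ha hb hab hM hN⟩
    · obtain ⟨P, hP, hPN, hPM⟩ := h.exists_mem_inter_of_full hb ha hba hN hM
      exact ⟨a, P, hP, hPM, hPN⟩
  exact ⟨P, mem_onLine.mpr ⟨mem_onLine.mpr ⟨h.subset j hP, hPM⟩, hPN⟩⟩

theorem top_eq_of_full_of_notMem_range (h : Configuration X d Y L) (hMr : M ∉ Set.range L)
    (hM : (onLine X M).card = d (Fin.last n)) : d (Fin.last n) = n + 1 := by
  obtain ⟨a, ha, rfl | ⟨rfl, -⟩⟩ := h.exists_hasLevel M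
  · exact absurd (Set.mem_range_self a) hMr
  have := h.card_onLine_add ha
  have := h.card_onLine_Y_le_one fun e => hMr ⟨0, e.symm⟩
  have := h.succ_le_top
  rw [Fin.val_zero] at *
  omega

end FullLines

theorem peel_le_add (h : Configuration X d Y L) {μ : Plane K → ℕ} {c : ℕ}
    (hμ : ∀ P ∈ X, μ P ≤ c + 1) {a : Fin (n + 1)} {P : Plane K} (hP : P ∈ onLine X (L a)) :
    peel μ (descending L (Finset.Ioi a)) P ≤
      c + open scoped Classical in if P ∈ Y a then 1 else 0 := by
  obtain ⟨hX, hPL⟩ := mem_onLine.mp hP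
  have hle := hμ P hX
  rw [peel]
  split_ifs with hPa
  · omega
  · obtain ⟨j, hj⟩ := (h.mem_iff P).mp hX
    have haj : a < j := (h.le_of_mem_points hj hPL).lt_of_ne fun e => hPa (e ▸ hj)
    have := through_pos (mem_descending.mpr ⟨j, Finset.mem_Ioi.mpr haj, rfl⟩) (h.mem_points hj)
    omega

theorem sum_peel_descending_le (h : Configuration X d Y L) {μ : Plane K → ℕ} {c : ℕ}
    (hμ : ∀ P ∈ X, μ P ≤ c + 1) (a : Fin (n + 1)) :
    ∑ P ∈ onLine X (L a), peel μ (descending L (Finset.Ioi a)) P ≤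
      c * d (Fin.last n) + d a := by
  classical
  have hsum := Finset.sum_le_sum fun P hP => h.peel_le_add hμ (a := a) (P := P) hP
  have hmul := Nat.mul_le_mul_left c (h.card_onLine_le_top (L a))
  have hY : ((onLine X (L a)).filter (· ∈ Y a)).card ≤ d a :=
    h.card a ▸ Finset.card_le_card fun P hP => (Finset.mem_filter.mp hP).2
  rw [Finset.sum_add_distrib, Finset.sum_const, Finset.sum_boole, Nat.cast_id, smul_eq_mul,
    mul_comm] at hsum
  omega

theorem defect_eq_zero (h : Configuration X d Y L) {μ : Plane K → ℕ} {c N : ℕ}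
    (hμ : ∀ P ∈ X, μ P ≤ c) (hN : c * d (Fin.last n) ≤ N) : defect X μ N = 0 := by
  induction c generalizing μ N with
  | zero => exact defect_eq_zero_of_forall_eq_zero (fun P hP => Nat.le_zero.mp (hμ P hP)) N
  | succ c ih =>
    have htop := h.succ_le_top
    rw [Nat.succ_mul] at hN
    have hlen : (descending L Finset.univ).length = n + 1 := by
      rw [length_descending, Finset.card_univ, Fintype.card_fin]
    obtain ⟨k, rfl⟩ : ∃ k, N = k + (descending L Finset.univ).length := ⟨N - (n + 1), by omega⟩
    refine ((defect_le_peel _ fun l₁ M l₂ hl => ?_).trans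
      (ih (N := k) (fun P hP => ?_) (by omega)).le).antisymm (defect_nonneg _ _ _)
    · have hlen' := congrArg List.length hl
      obtain ⟨a, -, rfl, rfl⟩ := descending_eq_append (fun _ _ _ _ => Finset.mem_univ _) hl
      simp only [List.length_append, List.length_cons, length_descending, Fin.card_Ioi,
        Finset.card_univ, Fintype.card_fin] at hlen'
      have := h.sum_peel_descending_le hμ a
      have := h.d_add_le a
      have := a.is_le
      omega
    · obtain ⟨j, hj⟩ := (h.mem_iff P).mp hP
      have := through_pos (mem_descending.mpr ⟨j, Finset.mem_univ j, rfl⟩) (h.mem_points hj)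
      have := hμ P hP
      rw [peel]
      omega

theorem defect_eq_of_full (h : Configuration X d Y L) {l : List (Line K)} (hnodup : l.Nodup)
    (hfull : ∀ M ∈ l, (onLine X M).card = d (Fin.last n)) {m N : ℕ} (hm : l.length ≤ m)
    (hN : N + l.length + 1 = m * d (Fin.last n)) :
    defect X (fun _ => m) (N + l.length) = defect X (peel (fun _ => m) l) N + l.length := by
  refine defect_eq_peel l fun l₁ M l₂ hl => ?_
  subst hl
  rw [List.length_append, List.length_cons] at hm hN
  have hM := hfull M (by simp)
  have hsum := sum_peel_const (X := X) (L := M) (l := l₁) (m := m) fun P _ =>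
    (through_le_length l₁ P).trans (by omega)
  have hone : (l₁.map fun N => (onLine (onLine X M) N).card) = l₁.map fun _ => 1 := by
    refine List.map_congr_left fun N hN => ?_
    refine h.card_onLine_onLine_of_full ?_ hM (hfull N (by simp [hN]))
    rintro rfl
    exact (List.nodup_append.mp hnodup).2.2 M hN M List.mem_cons_self rfl
  rw [hone, hM, List.map_const', List.sum_replicate, smul_eq_mul, mul_one] at hsum
  omega

section LongLastLine

theorem exists_eq_of_full_of_lt (h : Configuration X d Y L) (hlt : n + 1 < d (Fin.last n))
    {M : Line K} (hM : (onLine X M).card = d (Fin.last n)) : ∃ i, L i = M := by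
  by_contra hMr
  exact hlt.ne' (h.top_eq_of_full_of_notMem_range hMr hM)

theorem sum_peel_le_of_not_full (h : Configuration X d Y L) {M : Line K}
    (hM : (onLine X M).card ≠ d (Fin.last n)) (m : ℕ) (l : List (Line K)) :
    (∑ P ∈ onLine X M, peel (fun _ => m) l P) + m ≤ m * d (Fin.last n) := by
  have hlt := (h.card_onLine_le_top M).lt_of_ne hM
  calc (∑ P ∈ onLine X M, peel (fun _ => m) l P) + m
      ≤ (onLine X M).card • m + m :=
        Nat.add_le_add_right (Finset.sum_le_card_nsmul _ _ _ fun _ _ => Nat.sub_le _ _) m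
    _ = m * ((onLine X M).card + 1) := by rw [smul_eq_mul]; ring
    _ ≤ m * d (Fin.last n) := Nat.mul_le_mul_left m hlt

theorem card_full_le_of_lt (h : Configuration X d Y L) (hlt : n + 1 < d (Fin.last n))
    {D : Finset (Line K)} (hD : ∀ M ∈ D, (onLine X M).card = d (Fin.last n)) :
    D.card ≤ n + 1 := by
  classical
  have hDL : D ⊆ Finset.univ.image L := fun M hM =>
    Finset.mem_image.mpr (by simpa using h.exists_eq_of_full_of_lt hlt (hD M hM))
  exact (Finset.card_le_card hDL).trans (Finset.card_image_le.trans (by simp))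

theorem defect_peel_full_eq_zero_of_lt (h : Configuration X d Y L) (hlt : n + 1 < d (Fin.last n))
    {D : Finset (Line K)} (hD : ∀ M, M ∈ D ↔ (onLine X M).card = d (Fin.last n)) {m N : ℕ}
    (hm : n + 1 ≤ m) (hN : N + D.card + 1 = m * d (Fin.last n)) :
    defect X (peel (fun _ => m) D.toList) N = 0 := by
  classical
  set A := Finset.univ.image L
  have hLA (j : Fin (n + 1)) : L j ∈ A := Finset.mem_image_of_mem L (Finset.mem_univ j)
  have hA : A.card = n + 1 := by
    rw [Finset.card_image_of_injective _ h.injective, Finset.card_univ, Fintype.card_fin]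
  have hDA : D ⊆ A := fun M hM => by
    obtain ⟨i, rfl⟩ := h.exists_eq_of_full_of_lt hlt ((hD M).mp hM)
    exact hLA i
  have hcard := Finset.card_sdiff_add_card_eq_card hDA
  obtain ⟨c, rfl⟩ : ∃ c, m = c + 1 := ⟨m - 1, by omega⟩
  have hsucc : (c + 1) * d (Fin.last n) = c * d (Fin.last n) + d (Fin.last n) := Nat.succ_mul _ _
  obtain ⟨k, rfl⟩ : ∃ k, N = k + (A \ D).toList.length :=
    ⟨N - (A \ D).card, by rw [Finset.length_toList]; omega⟩
  rw [Finset.length_toList] at hN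
  refine ((defect_le_peel _ fun l₁ M l₂ hl => ?_).trans
    (h.defect_eq_zero (c := c) (N := k) (fun P hP => ?_) (by omega)).le).antisymm
    (defect_nonneg _ _ _)
  · have hM : M ∈ A \ D := by rw [← Finset.mem_toList, hl]; simp
    have := h.sum_peel_le_of_not_full (fun e => (Finset.mem_sdiff.mp hM).2 ((hD M).mpr e)) (c + 1)
      (D.toList ++ l₁)
    rw [← peel_append]
    omega
  · obtain ⟨j, hj⟩ := (h.mem_iff P).mp hP
    have hpos : 0 < through (D.toList ++ (A \ D).toList) P :=
      through_pos (L := L j) (by simpa [hLA j] using em (L j ∈ D)) (h.mem_points hj)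
    rw [← peel_append, peel]
    omega

end LongLastLine

end Configuration

theorem length_le_sum_card_add_card {ι β : Type*} {l : List ι} (hl : l.Nodup) (f : ι → Finset β)
    {B : Finset ι} (hB : ∀ i ∈ l, f i = ∅ → i ∈ B) :
    l.length ≤ (l.map fun i => (f i).card).sum + B.card := by
  classical
  rw [← List.toFinset_card_of_nodup hl, ← List.sum_toFinset _ hl,
    ← Finset.card_filter_add_card_filter_not (s := l.toFinset) fun i => f i ≠ ∅]
  refine Nat.add_le_add ?_ (Finset.card_le_card fun i hi => ?_)
  · rw [Finset.card_filter]
    refine Finset.sum_le_sum fun i _ => ?_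
    split_ifs with hi
    · exact Finset.card_pos.mpr (Finset.nonempty_iff_ne_empty.mpr hi)
    · exact Nat.zero_le _
  · rw [Finset.mem_filter, List.mem_toFinset, not_not] at hi
    exact hB i hi.1 hi.2

theorem through_toList_add_through_toList_sdiff [DecidableEq (Line K)] {D F : Finset (Line K)}
    (hDF : D ⊆ F) (P : Plane K) :
    through D.toList P + through (F \ D).toList P = through F.toList P := by
  classical
  simp only [through_toList]
  rw [← Finset.card_union_of_disjoint (Finset.disjoint_filter_filter Finset.disjoint_sdiff),
    ← Finset.filter_union, Finset.union_sdiff_of_subset hDF]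

theorem two_le_through_toList {F : Finset (Line K)} {M N : Line K} (hMN : M ≠ N) (hM : M ∈ F)
    (hN : N ∈ F) {P : Plane K} (hPM : P ∈ M.points) (hPN : P ∈ N.points) :
    2 ≤ through F.toList P := by
  classical
  rw [through_toList, Nat.succ_le_iff, Finset.one_lt_card]
  simp only [Finset.mem_filter]
  exact ⟨M, ⟨hM, hPM⟩, N, ⟨hN, hPN⟩, hMN⟩

namespace Configuration

variable {X : Finset (Plane K)} {n : ℕ} {d : Fin (n + 1) → ℕ}
  {Y : Fin (n + 1) → Finset (Plane K)} {L : Fin (n + 1) → Line K}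

theorem nodup_descending (h : Configuration X d Y L) (S : Finset (Fin (n + 1))) :
    (descending L S).Nodup :=
  (S.sort_nodup _).map h.injective

theorem mem_missing_of_onLine_eq_empty (h : Configuration X d Y L) {a j : Fin (n + 1)}
    (haj : a < j) (hempty : onLine (onLine X (L a)) (L j) = ∅) : j ∈ missing Y (L a) a := by
  refine mem_missing.mpr ⟨haj, Finset.eq_empty_of_forall_notMem fun P hP => ?_⟩
  rw [mem_onLine] at hP
  have : P ∈ onLine (onLine X (L a)) (L j) :=
    mem_onLine.mpr ⟨mem_onLine.mpr ⟨h.subset j hP.1, hP.2⟩, h.mem_points hP.1⟩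
  rw [hempty] at this
  exact Finset.notMem_empty _ this

theorem exists_mem_missing_of_full (h : Configuration X d Y L) {a : Fin (n + 1)} {M : Line K}
    (hM : (onLine X M).card = d (Fin.last n)) (hempty : onLine (onLine X (L a)) M = ∅) :
    ∃ j ∈ missing Y (L a) a, L j = M := by
  obtain ⟨b, hb, hMb⟩ := h.exists_hasLevel M
  rcases le_or_gt b a with hba | hab
  · obtain ⟨P, hP, hPM⟩ := h.exists_mem_of_full hb hM hba
    have : P ∈ onLine (onLine X (L a)) M :=
      mem_onLine.mpr ⟨mem_onLine.mpr ⟨h.subset a hP, h.mem_points hP⟩, hPM⟩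
    rw [hempty] at this
    exact absurd this (Finset.notMem_empty P)
  · obtain rfl : M = L b := hMb.resolve_right fun hb0 => (Fin.not_lt_zero a) (hb0.1 ▸ hab)
    exact ⟨b, h.mem_missing_of_onLine_eq_empty hab hempty, rfl⟩

theorem card_Ioi_le_sum_add_missing (h : Configuration X d Y L) (a : Fin (n + 1)) :
    (Finset.Ioi a).card ≤
      ((descending L (Finset.Ioi a)).map fun M => (onLine (onLine X (L a)) M).card).sum +
        (missing Y (L a) a).card := by
  classical
  rw [← length_descending L, ← Finset.card_image_of_injective (missing Y (L a) a) h.injective]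
  refine length_le_sum_card_add_card (h.nodup_descending _) _ fun M hM hempty => ?_
  obtain ⟨j, hj, rfl⟩ := mem_descending.mp hM
  exact Finset.mem_image_of_mem L
    (h.mem_missing_of_onLine_eq_empty (Finset.mem_Ioi.mp hj) hempty)

theorem card_full_le_sum_add_missing (h : Configuration X d Y L) {D : Finset (Line K)}
    (hD : ∀ M ∈ D, (onLine X M).card = d (Fin.last n)) (a : Fin (n + 1)) :
    D.card ≤ (D.toList.map fun M => (onLine (onLine X (L a)) M).card).sum +
      (missing Y (L a) a).card := by
  classical
  rw [← Finset.length_toList, ← Finset.card_image_of_injective (missing Y (L a) a) h.injective]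
  refine length_le_sum_card_add_card D.nodup_toList _ fun M hM hempty => ?_
  obtain ⟨j, hj, rfl⟩ := h.exists_mem_missing_of_full (hD M (Finset.mem_toList.mp hM)) hempty
  exact Finset.mem_image_of_mem L hj

theorem sum_card_full_add_one (h : Configuration X d Y L) {D : Finset (Line K)}
    (hD : ∀ M ∈ D, (onLine X M).card = d (Fin.last n)) {M : Line K} (hM : M ∈ D) :
    (D.toList.map fun N => (onLine (onLine X M) N).card).sum + 1 = D.card + d (Fin.last n) := by
  classical
  have hself : onLine (onLine X M) M = onLine X M := by
    ext P
    simp only [mem_onLine, and_assoc, and_self]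
  have hone : ∀ N ∈ D.erase M, (onLine (onLine X M) N).card = 1 := fun N hN =>
    h.card_onLine_onLine_of_full (Finset.ne_of_mem_erase hN).symm (hD M hM)
      (hD N (Finset.mem_of_mem_erase hN))
  rw [Finset.sum_map_toList, ← Finset.add_sum_erase _ _ hM, hself, hD M hM,
    Finset.sum_congr rfl hone, Finset.sum_const, smul_eq_mul, mul_one,
    ← Finset.card_erase_add_one hM]
  omega

theorem eq_of_full_of_mem (h : Configuration X d Y L) {M N : Line K} {j : Fin (n + 1)}
    {Q : Plane K} (hQ : Q ∈ Y j) (hQM : Q ∈ M.points) (hQN : Q ∈ N.points)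
    (hM : (onLine X M).card = d (Fin.last n)) (hN : (onLine X N).card = d (Fin.last n))
    (hj : 0 < j) (hMj : M ≠ L j) (hNj : N ≠ L j) : M = N := by
  have key {M : Line K} (hQM : Q ∈ M.points) (hMj : M ≠ L j) : ∃ a < j, HasLevel Y L M a := by
    obtain ⟨a, ha, rfl | ⟨rfl, -⟩⟩ := h.exists_hasLevel M
    · exact ⟨a, (h.le_of_mem_points hQ hQM).lt_of_ne fun e => hMj (e ▸ rfl), ha⟩
    · exact ⟨0, hj, ha⟩
  obtain ⟨a, haj, ha⟩ := key hQM hMj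
  obtain ⟨b, hbj, hb⟩ := key hQN hNj
  obtain ⟨i, hij, P, hP, hPM, hPN⟩ : ∃ i < j, ∃ P ∈ Y i, P ∈ M.points ∧ P ∈ N.points := by
    rcases le_total a b with hab | hba
    · exact ⟨b, hbj, h.exists_mem_inter_of_full ha hb hab hM hN⟩
    · obtain ⟨P, hP, hPN, hPM⟩ := h.exists_mem_inter_of_full hb ha hba hN hM
      exact ⟨a, haj, P, hP, hPM, hPN⟩
  exact line_eq_of_mem (fun e : P = Q => hij.ne (h.index_unique hP (e ▸ hQ))) hPM hQM hPN hQN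

theorem through_full_le_two (h : Configuration X d Y L) {D : Finset (Line K)}
    (hD : ∀ M ∈ D, (onLine X M).card = d (Fin.last n)) {j : Fin (n + 1)} {Q : Plane K}
    (hQ : Q ∈ Y j) (hj : 0 < j) : through D.toList Q ≤ 2 := by
  classical
  rw [through_toList]
  have hone : ((D.filter (Q ∈ Line.points ·)).erase (L j)).card ≤ 1 := by
    rw [Finset.card_le_one]
    intro M hM N hN
    simp only [Finset.mem_erase, Finset.mem_filter] at hM hN
    exact h.eq_of_full_of_mem hQ hM.2.2 hN.2.2 (hD M hM.2.1) (hD N hN.2.1) hj hM.1 hN.1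
  have := Finset.pred_card_le_card_erase (s := D.filter (Q ∈ Line.points ·)) (a := L j)
  omega

theorem eq_add_one_of_top_eq (h : Configuration X d Y L) (htop : d (Fin.last n) = n + 1)
    (a : Fin (n + 1)) : d a = a + 1 := by
  have hle := h.d_add_le a
  have hlow : (a : ℕ) + 1 ≤ d a := by
    induction a using Fin.induction with
    | zero => exact h.one_le 0
    | succ i ih =>
      have := h.strictMono i.castSucc_lt_succ
      have := ih (h.d_add_le _)
      simp only [Fin.val_succ, Fin.val_castSucc] at this ⊢
      omega
  omega

end Configuration

/-- A `𝕜`-configuration of type `(1, 2, …, k + 2)` whose first two point sets are `{P}` and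
`{A, B}`: given the other conditions on `d`, its last value determines all of them. -/
structure Staircase (X : Finset (Plane K)) {k : ℕ} (d : Fin (k + 2) → ℕ)
    (Y : Fin (k + 2) → Finset (Plane K)) (L : Fin (k + 2) → Line K) (P A B : Plane K) : Prop
    extends Configuration X d Y L where
  top_eq : d (Fin.last (k + 1)) = k + 2
  mem_zero_iff : ∀ {Q}, Q ∈ Y 0 ↔ Q = P
  mem_one_iff : ∀ {Q}, Q ∈ Y 1 ↔ Q = A ∨ Q = B
  left_ne_right : A ≠ B

theorem Configuration.exists_staircase {X : Finset (Plane K)} {k : ℕ} {d : Fin (k + 2) → ℕ}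
    {Y : Fin (k + 2) → Finset (Plane K)} {L : Fin (k + 2) → Line K} (h : Configuration X d Y L)
    (htop : d (Fin.last (k + 1)) = k + 2) : ∃ P A B, Staircase X d Y L P A B := by
  classical
  obtain ⟨P, hP⟩ := Finset.card_eq_one.mp
    ((h.card 0).trans (h.eq_add_one_of_top_eq htop 0) : (Y 0).card = 1)
  obtain ⟨A, B, hne, hAB⟩ := Finset.card_eq_two.mp
    ((h.card 1).trans (h.eq_add_one_of_top_eq htop 1) : (Y 1).card = 2)
  exact ⟨P, A, B, h, htop, by simp [hP], by simp [hAB], hne⟩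

namespace Staircase

variable {X : Finset (Plane K)} {k : ℕ} {d : Fin (k + 2) → ℕ}
  {Y : Fin (k + 2) → Finset (Plane K)} {L : Fin (k + 2) → Line K} {P A B : Plane K}

theorem apex_mem (h : Staircase X d Y L P A B) : P ∈ Y 0 := h.mem_zero_iff.mpr rfl

theorem left_mem (h : Staircase X d Y L P A B) : A ∈ Y 1 := h.mem_one_iff.mpr (Or.inl rfl)

theorem right_mem (h : Staircase X d Y L P A B) : B ∈ Y 1 := h.mem_one_iff.mpr (Or.inr rfl)

theorem apex_ne (h : Staircase X d Y L P A B) {Q : Plane K} (hQ : Q ∈ Y 1) : P ≠ Q := by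
  rintro rfl
  exact Fin.zero_ne_one (h.index_unique h.apex_mem hQ)

theorem lineThrough_ne (h : Staircase X d Y L P A B) {Q : Plane K} (hQ : Q ∈ Y 1)
    {j : Fin (k + 2)} (hj : 0 < j) : lineThrough (h.apex_ne hQ) ≠ L j := fun e =>
  h.notMem_points hj h.apex_mem (e ▸ left_mem_lineThrough (h.apex_ne hQ))

theorem not_collinear (h : Staircase X d Y L P A B) {M : Line K} (hP : P ∈ M.points)
    (hA : A ∈ M.points) (hB : B ∈ M.points) : False := by
  have hM : M = L 1 := line_eq_of_mem h.left_ne_right hA hB (h.mem_points h.left_mem)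
    (h.mem_points h.right_mem)
  exact h.notMem_points Fin.zero_lt_one h.apex_mem (hM ▸ hP)

theorem eq_of_mem_Y (h : Staircase X d Y L P A B) {Q : Plane K} {j : Fin (k + 2)} (hQ : Q ∈ Y j)
    (hj : j ≤ 1) : Q = P ∨ Q = A ∨ Q = B := by
  rcases hj.eq_or_lt with rfl | hj
  · exact Or.inr (h.mem_one_iff.mp hQ)
  · obtain rfl : j = 0 := (Fin.lt_one_iff j).mp hj
    exact Or.inl (h.mem_zero_iff.mp hQ)

open scoped Classical in
/-- The lines `L 1, …, L (k + 1)` of a staircase and the two lines joining `P` to `A` and to `B`.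
All lines with the maximal number of points are among them. -/
noncomputable def candidates (h : Staircase X d Y L P A B) : Finset (Line K) :=
  {lineThrough (h.apex_ne h.left_mem), lineThrough (h.apex_ne h.right_mem)} ∪
    (Finset.Ioi 0).image L

theorem mem_candidates (h : Staircase X d Y L P A B) {M : Line K} :
    M ∈ h.candidates ↔ (M = lineThrough (h.apex_ne h.left_mem) ∨
      M = lineThrough (h.apex_ne h.right_mem)) ∨ ∃ j, 0 < j ∧ L j = M := by
  simp only [candidates, Finset.mem_union, Finset.mem_insert, Finset.mem_singleton,
    Finset.mem_image, Finset.mem_Ioi]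

theorem lineThrough_mem_candidates (h : Staircase X d Y L P A B) {Q : Plane K} (hQ : Q ∈ Y 1) :
    lineThrough (h.apex_ne hQ) ∈ h.candidates := by
  rw [mem_candidates]
  rcases h.mem_one_iff.mp hQ with rfl | rfl
  · exact Or.inl (Or.inl rfl)
  · exact Or.inl (Or.inr rfl)

theorem L_mem_candidates (h : Staircase X d Y L P A B) {j : Fin (k + 2)} (hj : 0 < j) :
    L j ∈ h.candidates :=
  h.mem_candidates.mpr (Or.inr ⟨j, hj, rfl⟩)

theorem card_candidates_le (h : Staircase X d Y L P A B) : h.candidates.card ≤ k + 3 := by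
  rw [candidates]
  refine (Finset.card_union_le _ _).trans
    ((Nat.add_le_add Finset.card_le_two Finset.card_image_le).trans ?_)
  rw [Fin.card_Ioi, Fin.val_zero]
  omega

theorem mem_candidates_of_full (h : Staircase X d Y L P A B) {M : Line K}
    (hM : (onLine X M).card = d (Fin.last (k + 1))) : M ∈ h.candidates := by
  obtain ⟨a, ha, hMa⟩ := h.exists_hasLevel M
  rcases (Fin.zero_le a).eq_or_lt with rfl | hpos
  · have hPM := h.mem_points_of_full ha hM h.apex_mem
    obtain ⟨Q, hQ, hQM⟩ := h.exists_mem_of_full ha hM (Fin.zero_le 1)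
    exact eq_lineThrough (h.apex_ne hQ) hPM hQM ▸ h.lineThrough_mem_candidates hQ
  · exact hMa.resolve_right (fun h0 => hpos.ne' h0.1) ▸ h.L_mem_candidates hpos

theorem two_le_through_candidates (h : Staircase X d Y L P A B) {Q : Plane K}
    {j : Fin (k + 2)} (hQ : Q ∈ Y j) (hj : j ≤ 1) : 2 ≤ through h.candidates.toList Q := by
  rcases hj.eq_or_lt with rfl | hj
  · exact two_le_through_toList (h.lineThrough_ne hQ Fin.zero_lt_one)
      (h.lineThrough_mem_candidates hQ) (h.L_mem_candidates Fin.zero_lt_one)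
      (right_mem_lineThrough _) (h.mem_points hQ)
  · obtain rfl : j = 0 := (Fin.lt_one_iff j).mp hj
    obtain rfl : Q = P := h.mem_zero_iff.mp hQ
    refine two_le_through_toList (fun e => ?_) (h.lineThrough_mem_candidates h.left_mem)
      (h.lineThrough_mem_candidates h.right_mem) (left_mem_lineThrough _) (left_mem_lineThrough _)
    exact h.not_collinear (left_mem_lineThrough _) (right_mem_lineThrough (h.apex_ne h.left_mem))
      (e ▸ right_mem_lineThrough (h.apex_ne h.right_mem))

theorem through_full_le_two (h : Staircase X d Y L P A B) {D : Finset (Line K)}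
    (hD : ∀ M ∈ D, (onLine X M).card = d (Fin.last (k + 1))) {Q : Plane K} (hQ : Q ∈ X) :
    through D.toList Q ≤ 2 := by
  classical
  obtain ⟨j, hj⟩ := (h.mem_iff Q).mp hQ
  rcases (Fin.zero_le j).eq_or_lt with rfl | hpos
  · rw [through_toList]
    refine (Finset.card_le_card fun M hM => ?_).trans (Finset.card_le_two
      (a := lineThrough (h.apex_ne h.left_mem)) (b := lineThrough (h.apex_ne h.right_mem)))
    rw [Finset.mem_filter] at hM
    rw [Finset.mem_insert, Finset.mem_singleton]
    refine (h.mem_candidates.mp (h.mem_candidates_of_full (hD M hM.1))).resolve_right ?_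
    rintro ⟨i, hi, rfl⟩
    exact h.notMem_points hi hj hM.2
  · exact h.toConfiguration.through_full_le_two hD hj hpos

theorem card_onLine_add_missing (h : Staircase X d Y L P A B) (a : Fin (k + 2)) :
    (onLine X (L a)).card + (missing Y (L a) a).card = k + 2 := by
  have hadd := h.card_onLine_add (h.hasLevel a)
  have hY : onLine (Y a) (L a) = Y a :=
    (onLine_subset _ _).antisymm fun Q hQ => mem_onLine.mpr ⟨hQ, h.mem_points hQ⟩
  rw [hY, h.card, h.eq_add_one_of_top_eq h.top_eq] at hadd
  omega

theorem sum_peel_full_descending_le (h : Staircase X d Y L P A B) {D : Finset (Line K)}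
    (hD : ∀ M, M ∈ D ↔ (onLine X M).card = d (Fin.last (k + 1))) {m : ℕ} (hm : k + 3 ≤ m)
    (a : Fin (k + 2)) :
    (∑ Q ∈ onLine X (L a), peel (fun _ => m) (D.toList ++ descending L (Finset.Ioi a)) Q) +
      D.card + (Finset.Ioi a).card + 1 ≤ m * (k + 2) := by
  have hfull : ∀ M ∈ D, (onLine X M).card = d (Fin.last (k + 1)) := fun M => (hD M).mp
  have hsum := sum_peel_const (X := X) (L := L a) (l := D.toList ++ descending L (Finset.Ioi a))
    (m := m) fun Q hQ => by
      have := h.through_full_le_two hfull (mem_onLine.mp hQ).1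
      have := through_le_length (descending L (Finset.Ioi a)) Q
      rw [length_descending, Fin.card_Ioi] at this
      rw [through_append]
      omega
  rw [List.map_append, List.sum_append] at hsum
  have hmissing := h.card_onLine_add_missing a
  have hDa := h.card_full_le_sum_add_missing hfull a
  have hIoi := h.card_Ioi_le_sum_add_missing a
  rcases (missing Y (L a) a).card.eq_zero_or_pos with hw | hw
  · have hLa : (onLine X (L a)).card = k + 2 := by omega
    have hDsum := h.sum_card_full_add_one hfull ((hD _).mpr (hLa.trans h.top_eq.symm))
    rw [h.top_eq] at hDsum
    rw [hLa] at hsum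
    omega
  · have hmul : m * (onLine X (L a)).card + m * (missing Y (L a) a).card = m * (k + 2) := by
      rw [← mul_add, hmissing]
    have := Nat.mul_le_mul_right (missing Y (L a) a).card (by omega : 3 ≤ m)
    omega

theorem defect_peel_full_le_descending (h : Staircase X d Y L P A B) {D : Finset (Line K)}
    (hD : ∀ M, M ∈ D ↔ (onLine X M).card = d (Fin.last (k + 1))) {m N : ℕ} (hm : k + 3 ≤ m)
    (hN : N + (descending L (Finset.Ioi 1)).length + D.card + 1 = m * (k + 2)) :
    defect X (peel (fun _ => m) D.toList) (N + (descending L (Finset.Ioi 1)).length) ≤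
      defect X (peel (fun _ => m) (D.toList ++ descending L (Finset.Ioi 1))) N := by
  rw [peel_append]
  refine defect_le_peel _ fun l₁ M l₂ hl => ?_
  have hlen := congrArg List.length hl
  obtain ⟨a, -, rfl, rfl⟩ := descending_eq_append
    (fun i j hij hi => by simpa using (by simpa using hi : 1 < i).trans_le hij) hl
  rw [List.length_append, List.length_cons, length_descending L (Finset.Ioi a)] at hlen
  have := h.sum_peel_full_descending_le hD hm a
  rw [← peel_append]
  omega

theorem exists_le_one_of_through_eq_zero (h : Staircase X d Y L P A B) {Q : Plane K}
    (hQ : Q ∈ X) (hthrough : through (descending L (Finset.Ioi 1)) Q = 0) :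
    ∃ j ≤ 1, Q ∈ Y j := by
  obtain ⟨j, hj⟩ := (h.mem_iff Q).mp hQ
  refine ⟨j, not_lt.mp fun hlt => ?_, hj⟩
  exact (through_pos (mem_descending.mpr ⟨j, Finset.mem_Ioi.mpr hlt, rfl⟩)
    (h.mem_points hj)).ne' hthrough

theorem card_filter_through_eq_zero_le_two (h : Staircase X d Y L P A B) (M : Line K) :
    ((onLine X M).filter fun Q => through (descending L (Finset.Ioi 1)) Q = 0).card ≤ 2 := by
  classical
  set U := (onLine X M).filter fun Q => through (descending L (Finset.Ioi 1)) Q = 0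
  have hUM {Q : Plane K} (hQ : Q ∈ U) : Q ∈ M.points :=
    (mem_onLine.mp (Finset.mem_filter.mp hQ).1).2
  have hss : U ⊂ {P, A, B} := by
    refine Finset.ssubset_iff_subset_ne.mpr ⟨fun Q hQ => ?_, fun e => ?_⟩
    · obtain ⟨hQM, hQ0⟩ := Finset.mem_filter.mp hQ
      obtain ⟨j, hj, hQj⟩ := h.exists_le_one_of_through_eq_zero (mem_onLine.mp hQM).1 hQ0
      simpa using h.eq_of_mem_Y hQj hj
    · exact h.not_collinear (hUM (by simp [e])) (hUM (by simp [e])) (hUM (by simp [e]))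
  exact Nat.lt_succ_iff.mp ((Finset.card_lt_card hss).trans_le Finset.card_le_three)

theorem card_unpeeled_le (h : Staircase X d Y L P A B) [DecidableEq (Line K)]
    {D : Finset (Line K)} (hD : D ⊆ h.candidates) {l₁ l₂ : List (Line K)} {M : Line K}
    (hl : (h.candidates \ D).toList = l₁ ++ M :: l₂) :
    ((onLine X M).filter fun Q =>
      through (D.toList ++ descending L (Finset.Ioi 1) ++ l₁) Q = 0).card ≤ l₂.length + 1 := by
  simp only [through_append, Nat.add_eq_zero_iff]
  rcases l₂ with - | ⟨M', l₂⟩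
  · rw [Finset.filter_eq_empty_iff.mpr, Finset.card_empty]
    · exact Nat.zero_le _
    rintro Q hQ ⟨⟨hQD, hQdesc⟩, hQl₁⟩
    obtain ⟨j, hj, hQj⟩ := h.exists_le_one_of_through_eq_zero (mem_onLine.mp hQ).1 hQdesc
    have htwo := h.two_le_through_candidates hQj hj
    rw [← through_toList_add_through_toList_sdiff hD, hl, through_append, hQD, hQl₁] at htwo
    have := through_le_length [M] Q
    rw [List.length_singleton] at this
    omega
  · refine (Finset.card_le_card (Finset.monotone_filter_right _ fun Q _ hQ => hQ.1.2)).trans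
      ((h.card_filter_through_eq_zero_le_two M).trans ?_)
    rw [List.length_cons]
    omega

theorem sum_peel_remaining_le (h : Staircase X d Y L P A B) [DecidableEq (Line K)]
    {D : Finset (Line K)} (hD : ∀ M, M ∈ D ↔ (onLine X M).card = d (Fin.last (k + 1))) {c : ℕ}
    (hc : k + 1 ≤ c) {l₁ l₂ : List (Line K)} {M : Line K}
    (hl : (h.candidates \ D).toList = l₁ ++ M :: l₂) :
    ∑ Q ∈ onLine X M, peel (fun _ => c + 2)
      (D.toList ++ descending L (Finset.Ioi 1) ++ l₁) Q ≤ c * (k + 2) + l₂.length + 1 := by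
  have hMD : M ∉ D := by
    have : M ∈ h.candidates \ D := by rw [← Finset.mem_toList, hl]; simp
    exact (Finset.mem_sdiff.mp this).2
  have hMtop : (onLine X M).card ≤ k + 1 := by
    have hle := h.card_onLine_le_top M
    have hne := mt (hD M).mpr hMD
    rw [h.top_eq] at hle hne
    omega
  refine (sum_peel_const_le X M _ (c + 1)).trans ?_
  have hunpeeled := h.card_unpeeled_le (fun M hM => h.mem_candidates_of_full ((hD M).mp hM)) hl
  have hmul := Nat.mul_le_mul_left (c + 1) hMtop
  have hring : (c + 1) * (k + 1) + c + 1 = c * (k + 2) + k + 2 := by ring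
  omega

theorem peel_candidates_le (h : Staircase X d Y L P A B) [DecidableEq (Line K)]
    {D : Finset (Line K)} (hD : D ⊆ h.candidates) (c : ℕ) {Q : Plane K} (hQ : Q ∈ X) :
    peel (fun _ => c + 2)
      (D.toList ++ descending L (Finset.Ioi 1) ++ (h.candidates \ D).toList) Q ≤ c := by
  obtain ⟨j, hj⟩ := (h.mem_iff Q).mp hQ
  have hadd := through_toList_add_through_toList_sdiff hD Q
  rw [peel, through_append, through_append]
  rcases le_or_gt j 1 with hj1 | hj1
  · have := h.two_le_through_candidates hj hj1
    omega
  · have := through_pos (mem_descending.mpr ⟨j, Finset.mem_Ioi.mpr hj1, rfl⟩) (h.mem_points hj)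
    have := through_pos (Finset.mem_toList.mpr (h.L_mem_candidates (Fin.zero_lt_one.trans hj1)))
      (h.mem_points hj)
    omega

theorem card_full_le (h : Staircase X d Y L P A B) {D : Finset (Line K)}
    (hD : ∀ M ∈ D, (onLine X M).card = d (Fin.last (k + 1))) : D.card ≤ k + 3 :=
  (Finset.card_le_card fun M hM => h.mem_candidates_of_full (hD M hM)).trans h.card_candidates_le

theorem defect_peel_full_eq_zero (h : Staircase X d Y L P A B) {D : Finset (Line K)}
    (hD : ∀ M, M ∈ D ↔ (onLine X M).card = d (Fin.last (k + 1))) {m N : ℕ} (hm : k + 3 ≤ m)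
    (hN : N + D.card + 1 = m * d (Fin.last (k + 1))) :
    defect X (peel (fun _ => m) D.toList) N = 0 := by
  classical
  have hsub : D ⊆ h.candidates := fun M hM => h.mem_candidates_of_full ((hD M).mp hM)
  have hcard := Finset.card_sdiff_add_card_eq_card hsub
  have hcandidates := h.card_candidates_le
  obtain ⟨c, rfl⟩ : ∃ c, m = c + 2 := ⟨m - 2, by omega⟩
  have hlen : (descending L (Finset.Ioi 1)).length = k := by
    rw [length_descending, Fin.card_Ioi, Fin.val_one]
    omega
  have hadd : (c + 2) * (k + 2) = c * (k + 2) + 2 * (k + 2) := Nat.add_mul _ _ _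
  rw [h.top_eq] at hN
  obtain ⟨i, rfl⟩ : ∃ i, N = c * (k + 2) + i + (h.candidates \ D).toList.length +
      (descending L (Finset.Ioi 1)).length :=
    ⟨N - (c * (k + 2) + (h.candidates \ D).card + k), by rw [hlen, Finset.length_toList]; omega⟩
  refine ((h.defect_peel_full_le_descending hD hm (by omega)).trans
    ((defect_le_peel _ fun l₁ M l₂ hl => ?_).trans
      (h.defect_eq_zero (c := c) (N := c * (k + 2) + i) (fun Q hQ => ?_) ?_).le)).antisymm
    (defect_nonneg _ _ _)
  · rw [← peel_append]
    exact (h.sum_peel_remaining_le hD (by omega) hl).trans (by omega)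
  · rw [← peel_append]
    exact h.peel_candidates_le hsub c hQ
  · rw [h.top_eq]
    exact Nat.le_add_right _ _

end Staircase

namespace Configuration

variable {X : Finset (Plane K)} {n : ℕ} {d : Fin (n + 1) → ℕ}
  {Y : Fin (n + 1) → Finset (Plane K)} {L : Fin (n + 1) → Line K}

theorem two_le_top (h : Configuration X d Y L) (hd : List.ofFn d ≠ [1]) : 2 ≤ d (Fin.last n) := by
  by_contra! hlt
  obtain rfl : n = 0 := by
    have := h.succ_le_top
    omega
  have hone : d 0 = 1 := (Nat.lt_succ_iff.mp hlt).antisymm (h.one_le 0)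
  exact hd (by simp [hone])

variable {D : Finset (Line K)}

theorem card_full_le (h : Configuration X d Y L) (htop : 2 ≤ d (Fin.last n))
    (hD : ∀ M ∈ D, (onLine X M).card = d (Fin.last n)) : D.card ≤ n + 2 := by
  rcases h.succ_le_top.lt_or_eq with hlt | heq
  · exact (h.card_full_le_of_lt hlt hD).trans (Nat.le_succ _)
  · obtain ⟨k, rfl⟩ : ∃ k, n = k + 1 := ⟨n - 1, by omega⟩
    obtain ⟨P, A, B, hstair⟩ := h.exists_staircase heq.symm
    exact hstair.card_full_le hD

theorem defect_peel_full_eq_zero (h : Configuration X d Y L) (htop : 2 ≤ d (Fin.last n))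
    (hD : ∀ M, M ∈ D ↔ (onLine X M).card = d (Fin.last n)) {m N : ℕ} (hm : n + 2 ≤ m)
    (hN : N + D.card + 1 = m * d (Fin.last n)) :
    defect X (peel (fun _ => m) D.toList) N = 0 := by
  rcases h.succ_le_top.lt_or_eq with hlt | heq
  · exact h.defect_peel_full_eq_zero_of_lt hlt hD (by omega) hN
  · obtain ⟨k, rfl⟩ : ∃ k, n = k + 1 := ⟨n - 1, by omega⟩
    obtain ⟨P, A, B, hstair⟩ := h.exists_staircase heq.symm
    exact hstair.defect_peel_full_eq_zero hD hm hN

theorem isLastNonzeroValue_card (h : Configuration X d Y L) (htop : 2 ≤ d (Fin.last n))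
    (hD : ∀ M, M ∈ D ↔ (onLine X M).card = d (Fin.last n)) {m : ℕ} (hm : n + 2 ≤ m) :
    IsLastNonzeroValue (firstDifference (hilbertFunction (fatIdeal m X))) (D.card : ℤ) := by
  have hfull : ∀ M ∈ D, (onLine X M).card = d (Fin.last n) := fun M => (hD M).mp
  have hDm : D.card ≤ m := (h.card_full_le htop hfull).trans hm
  have hpos : 0 < D.card := Finset.card_pos.mpr ⟨_, (hD _).mpr h.card_onLine_last⟩
  obtain ⟨N, hN⟩ : ∃ N, N + D.card + 1 = m * d (Fin.last n) :=
    ⟨m * d (Fin.last n) - D.card - 1, by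
      have := Nat.mul_le_mul_left m htop
      omega⟩
  have hlast : defect X (fun _ => m) (N + D.card) = D.card := by
    have := h.defect_eq_of_full D.nodup_toList (fun M hM => hfull M (Finset.mem_toList.mp hM))
      (m := m) (N := N) (by rwa [Finset.length_toList]) (by rwa [Finset.length_toList])
    rwa [h.defect_peel_full_eq_zero htop hD hm hN, zero_add, Finset.length_toList] at this
  have hzero (t : ℕ) (ht : N + D.card < t) : defect X (fun _ => m) t = 0 :=
    h.defect_eq_zero (fun _ _ => le_rfl) (by omega)
  refine ⟨N + D.card, ?_, by exact_mod_cast hpos.ne', fun u hu => ?_⟩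
  · rw [firstDifference_hilbertFunction_fatIdeal, hlast, hzero _ (Nat.lt_succ_self _), sub_zero]
  · rw [firstDifference_hilbertFunction_fatIdeal, hzero u hu,
      hzero (u + 1) (hu.trans u.lt_succ_self), sub_zero]

end Configuration

end KConf

theorem mainTheorem8_general {K : Type*} [Field K] (X : Finset (KConf.Plane K))
    (s : ℕ) (hs : 0 < s) (d : Fin s → ℕ) (hX : KConf.IsKConfiguration X d)
    (hd : List.ofFn d ≠ [1]) (m : ℕ) (hm : s + 1 ≤ m) :
    (KConf.linesWithExactly X (d ⟨s - 1, Nat.sub_lt hs Nat.one_pos⟩)).Finite ∧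
      KConf.IsLastNonzeroValue
        (KConf.firstDifference (KConf.hilbertFunction (KConf.fatIdeal m X)))
        ((KConf.linesWithExactly X (d ⟨s - 1, Nat.sub_lt hs Nat.one_pos⟩)).ncard : ℤ) := by
  obtain ⟨n, rfl⟩ : ∃ n, s = n + 1 := ⟨s - 1, (Nat.succ_pred hs.ne').symm⟩
  obtain ⟨Y, L, h⟩ := hX.exists_configuration
  have htop := h.two_le_top hd
  have hfinite := KConf.linesWithExactly_finite X htop
  refine ⟨hfinite, ?_⟩
  have := h.isLastNonzeroValue_card htop (D := hfinite.toFinset) (fun M => by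
    rw [Set.Finite.mem_toFinset, KConf.mem_linesWithExactly_iff]) hm
  rwa [← Set.ncard_eq_toFinset_card _ hfinite] at this

theorem mainTheorem8 {K : Type*} [Field K] [IsAlgClosed K] (X : Finset (KConf.Plane K))
    (s : ℕ) (hs : 0 < s) (d : Fin s → ℕ) (hX : KConf.IsKConfiguration X d)
    (hd : List.ofFn d ≠ [1]) (m : ℕ) (hm : s + 1 ≤ m) :
    (KConf.linesWithExactly X (d ⟨s - 1, Nat.sub_lt hs Nat.one_pos⟩)).Finite ∧
      KConf.IsLastNonzeroValue
        (KConf.firstDifference (KConf.hilbertFunction (KConf.fatIdeal m X)))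
        ((KConf.linesWithExactly X (d ⟨s - 1, Nat.sub_lt hs Nat.one_pos⟩)).ncard : ℤ) :=
  mainTheorem8_general X s hs d hX hd m hm
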